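/- **Setting.** Let $T$ be a finite tree with root $r$, and $(f_i)_{i\ge1}$ a sequence of non-negative integers. In the game \textsc{Firefighter}, $r$ burns initially; at each turn $i\ge 1$ the player protects at most $f_i$ vertices that are neither burning nor already protected, and then the fire spreads to every unprotected neighbour of a burning vertex. Burning and protected vertices stay so for ever. The value of a play is the number of vertices that never burn, and $\beta_I$ is the largest value over all plays, $(f_i)$ being known in advance. A (deterministic) online algorithm $\mathbf{OA}$ knows $(T,r)$, but its move at turn $i$ depends only on $f_1,\dots,f_i$; its value is $\lambda_{\mathbf{OA}}$. The ratio $\lambda_{\mathbf{OA}}/\beta_I$ is read as $1$ if $\beta_I=0$. For $\gamma\in(0,1]$, $\mathbf{OA}$ is $\gamma$-competitive on a class of instances $(T,r,(f_i))$ if $\lambda_{\mathbf{OA}}/\beta_I\ge\gamma$ on all of them, and optimal if it is $\gamma$-competitive for the largest $\gamma$ for which a $\gamma$-competitive online algorithm exists. Put $$\alpha_{I,k}=\inf_{T}\ \max_{\mathbf{OA}}\ \min_{\sum_i f_i\le k}\ \frac{\lambda_{\mathbf{OA}}}{\beta_I},\qquad \alpha_I=\lim_{k\to\infty}\alpha_{I,k},\qquad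 \varphi=\frac{1+\sqrt5}2 ,$$ where $T$ ranges over the finite rooted trees and $\mathbf{OA}$ over the online algorithms. The weight $w_v$ of a vertex $v$ is the number of vertices of the subtree $T[v]$ formed by $v$ and its descendants; the level of a vertex is its distance from $r$; $\bar w_{v,j}$ is the maximum weight of a vertex of level $j$ in $T[v]$, and $0$ if there is none; $h$ is the maximum level. *Greedy algorithm.* At turn $i$ it protects a set of at most $f_i$ vertices of level $i$ without protected ancestors, of maximum total weight. *Two-firefighter algorithm.* The firefighters presented at a turn are handled one by one; let $C$ be the set of the vertices, at that moment, that are neither burning nor protected and have a burning neighbour. If $C=\emptyset$ the firefighter is not used. The first firefighter that is used, say at turn $t$: let $a,b\in C$ be two vertices of maximum weights, $w_a\ge w_b$ ($a=b$ if $|C|=1$); protect $a$ if $\frac{w_a+\bar w_{b,j}}{w_b+\bar w_{a,j}}\ge\frac1\varphi$ for all $t+1\le j\le h+1$, and $b$ otherwise. Every later firefighter is placed on a vertex of maximum weight in $C$. (In both algorithms ties are broken arbitrarily.) *The tree $W_{k,l,m}$* ($k\ge1$, $l\ge2$, $m\ge1$, $k\mid m-1$). The root $r$ has two children $x$ and $y$.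 The vertex $x$ has a single child, which has $l-2$ children, all of them leaves, so that $T[x]$ has $l$ vertices; below $y$ hang $k$ chains of $(m-1)/k$ vertices each, so that $T[y]$ has $m$ vertices. **Proposition.** For all $k\ge 2$, $\frac12\le\alpha_{I,k}\le\frac1\varphi$. More precisely: (i) $\alpha_I=\frac12$ (in particular the limit exists). The greedy algorithm is $\frac12$-competitive for \textsc{Firefighter} on finite trees, and no online algorithm is $\gamma$-competitive for any $\gamma>\frac12$; so greedy is optimal. (ii) $\alpha_{I,2}=\frac1\varphi$. The two-firefighter algorithm is $\frac1\varphi$-competitive on the instances with at most two firefighters in total, and no online algorithm is $\gamma$-competitive on these instances for any $\gamma>\frac1\varphi$; so it is optimal there. (iii) $\alpha_{I,4}<\frac1\varphi$. This is witnessed by the tree $T=W_{4,901,1001}$: on it, $\max_{\mathbf{OA}}\min_{\sum_i f_i\le 4}\lambda_{\mathbf{OA}}/\beta_I<\frac1\varphi$. -/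

import Mathlib

open Filter Topology

namespace Firefighter

noncomputable section

/-- A finite tree with a distinguished vertex `root`, where the fire breaks out. -/
structure RootedTree where
  V : Type
  [fintype : Fintype V]
  graph : SimpleGraph V
  isTree : graph.IsTree
  root : V

attribute [instance] RootedTree.fintype

/-! ### The game

Turns are numbered from `0`: index `t` of a firefighter sequence `f`, or of a play `p`, is the
`(t+1)`-st turn of the game. -/

section Game

variable (T : RootedTree)

/-- The vertices protected during the first `n` turns of the play `p`. -/
def protectedBy (p : ℕ → Finset T.V) (n : ℕ) : Set T.V :=
  {v | ∃ t < n, v ∈ p t}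

/-- The vertices that are burning after `n` turns of the play `p`: in each turn the protections
are placed first, then the fire spreads to all unprotected neighbours of burning vertices. -/
def burnt (p : ℕ → Finset T.V) : ℕ → Set T.V
  | 0 => {T.root}
  | n + 1 => burnt p n ∪
      {v | (∃ u ∈ burnt p n, T.graph.Adj u v) ∧ v ∉ protectedBy T p (n + 1)}

/-- `p` is a legal play for the firefighter sequence `f`: in each turn at most as many vertices
are protected as there are firefighters, none of them burning or already protected. -/
def Legal (f : ℕ → ℕ) (p : ℕ → Finset T.V) : Prop :=
  ∀ t, (p t).card ≤ f t ∧ ∀ v ∈ p t, v ∉ burnt T p t ∧ v ∉ protectedBy T p t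

/-- The number of vertices that never burn. -/
def saved (p : ℕ → Finset T.V) : ℕ :=
  {v : T.V | ∀ n, v ∉ burnt T p n}.ncard

/-- The offline optimal value `β_I`. -/
def offlineOpt (f : ℕ → ℕ) : ℕ :=
  sSup {s : ℕ | ∃ p, Legal T f p ∧ saved T p = s}

/-- A (deterministic) online algorithm on the tree `T`: it answers every firefighter sequence by a
legal play, and its move in a turn depends only on what has been revealed up to that turn. -/
structure Strategy where
  play : (ℕ → ℕ) → ℕ → Finset T.V
  legal : ∀ f, Legal T f (play f)
  causal : ∀ f g t, (∀ s ≤ t, f s = g s) → play f t = play g t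

/-- The performance `λ / β_I` of an online algorithm on a firefighter sequence; it is `1` by
convention when no vertex can be saved. -/
def ratio (A : Strategy T) (f : ℕ → ℕ) : ℝ :=
  if offlineOpt T f = 0 then 1 else (saved T (A.play f) : ℝ) / (offlineOpt T f : ℝ)

end Game

/-- The firefighter sequences with at most `k` firefighters in total. -/
def atMost (k : ℕ) : Set (ℕ → ℕ) :=
  {f | ∀ n, ∑ t ∈ Finset.range n, f t ≤ k}

/-- The best performance that an online algorithm can guarantee on the tree `T` against all
sequences of at most `k` firefighters. -/
def treeValue (k : ℕ) (T : RootedTree) : ℝ :=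
  ⨆ A : Strategy T, ⨅ f : atMost k, ratio T A f

/-- The optimal competitive ratio `α_{I,k}` on finite trees with at most `k` firefighters. -/
def alpha (k : ℕ) : ℝ :=
  ⨅ T : RootedTree, treeValue k T

/-- An online algorithm for finite trees; tree and root are known from the start. -/
abbrev OnlineAlgorithm := ∀ T : RootedTree, Strategy T

/-- `A` is `γ`-competitive on the instances whose firefighter sequence lies in `F`. -/
def Competitive (A : OnlineAlgorithm) (F : Set (ℕ → ℕ)) (γ : ℝ) : Prop :=
  0 < γ ∧ γ ≤ 1 ∧ ∀ T, ∀ f ∈ F, γ ≤ ratio T (A T) f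

/-- `A` guarantees the competitive ratio `γ` on the instances in `F`, and this is the best possible
competitive ratio on these instances. -/
def OptimalWithRatio (A : OnlineAlgorithm) (F : Set (ℕ → ℕ)) (γ : ℝ) : Prop :=
  Competitive A F γ ∧ ∀ (B : OnlineAlgorithm) (γ' : ℝ), Competitive B F γ' → γ' ≤ γ

/-! ### The rooted structure of a tree -/

section Rooted

variable (T : RootedTree)

/-- The level of a vertex: its distance from the root. -/
def level (v : T.V) : ℕ := T.graph.dist T.root v

/-- `u` is `v` or an ancestor of `v`: it lies on the path from the root to `v`. -/
def AncestorOrEq (u v : T.V) : Prop :=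
  level T u + T.graph.dist u v = level T v

/-- The weight of `v`: the number of vertices of the subtree consisting of `v` and its
descendants. -/
def weight (v : T.V) : ℕ := {u | AncestorOrEq T v u}.ncard

/-- The height of the tree. -/
def height : ℕ := Finset.univ.sup (level T)

open Classical in
/-- The maximum weight of a vertex of level `j` in the subtree of `v` (`0` if there is none). -/
def maxWeightBelow (v : T.V) (j : ℕ) : ℕ :=
  (Finset.univ.filter fun u => AncestorOrEq T v u ∧ level T u = j).sup (weight T)

end Rooted

/-! ### The greedy algorithm -/

section Greedy

variable (T : RootedTree)

/-- `X` is an admissible set of new protections for turn `t` (the `(t+1)`-st turn) after the play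
`p`, given `n` firefighters: at most `n` vertices of level `t + 1` without protected ancestors. -/
def GreedyFeasible (p : ℕ → Finset T.V) (t n : ℕ) (X : Finset T.V) : Prop :=
  X.card ≤ n ∧ ∀ v ∈ X, level T v = t + 1 ∧
    ∀ u, AncestorOrEq T u v → u ≠ v → u ∉ protectedBy T p t

/-- A greedy strategy maximises in each turn the total weight of the newly protected vertices. -/
def IsGreedyOn (A : Strategy T) : Prop :=
  ∀ f t, GreedyFeasible T (A.play f) t (f t) (A.play f t) ∧
    ∀ X, GreedyFeasible T (A.play f) t (f t) X →
      ∑ v ∈ X, weight T v ≤ ∑ v ∈ A.play f t, weight T v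

end Greedy

/-- `A` is a greedy algorithm (ties are broken arbitrarily). -/
def IsGreedy (A : OnlineAlgorithm) : Prop := ∀ T, IsGreedyOn T (A T)

/-! ### The algorithm for two firefighters

Contracting the burning vertices to a new root and deleting the subtrees of the protected vertices
gives the updated tree on which the algorithm works. -/

section TwoFirefighters

variable (T : RootedTree)

/-- The children of the root in the updated tree, when `B` is the set of burning vertices and `Q`
the set of protected vertices. -/
def children (B Q : Set T.V) : Set T.V :=
  {v | v ∉ B ∧ v ∉ Q ∧ ∃ u ∈ B, T.graph.Adj u v}

/-- `a`, `b` are two elements of `C` of maximum weights, `a` being the heavier; `a = b` exactly if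
`C` has only one element. -/
def IsTopPair (C : Set T.V) (a b : T.V) : Prop :=
  a ∈ C ∧ b ∈ C ∧ (∀ u ∈ C, weight T u ≤ weight T a) ∧
    (∀ u ∈ C, u ≠ a → weight T u ≤ weight T b) ∧ (a = b → C = {a})

/-- The test deciding whether the first firefighter, presented in turn `t`, is placed on `a`.
Level `i` of the updated tree is level `t + i` of `T`, and the height of the updated tree is
`height T - t`; so `i` ranging over `2 ≤ i ≤ 1 + (height T - t)` means that `j = t + i` ranges over
`t + 2 ≤ j ≤ height T + 1`. -/
def FirstTest (t : ℕ) (a b : T.V) : Prop :=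
  ∀ j, t + 2 ≤ j → j ≤ height T + 1 →
    1 / Real.goldenRatio ≤
      ((weight T a : ℝ) + maxWeightBelow T b j) / ((weight T b : ℝ) + maxWeightBelow T a j)

/-- The algorithm may place a firefighter on `v` in turn `t` if `B` is burning and `Q` is protected;
it is the first firefighter if `Q` is empty. -/
def Choice (t : ℕ) (B Q : Set T.V) (v : T.V) : Prop :=
  (Q = ∅ → ∃ a b, IsTopPair T (children T B Q) a b ∧
    (FirstTest T t a b → v = a) ∧ (¬ FirstTest T t a b → v = b)) ∧
  (Q ≠ ∅ → v ∈ children T B Q ∧ ∀ u ∈ children T B Q, weight T u ≤ weight T v)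

/-- `Serve T t B Q n Q'`: handling `n` firefighters one by one in turn `t`, while `B` is burning,
the algorithm can enlarge the set of protected vertices from `Q` to `Q'`. -/
inductive Serve (t : ℕ) (B : Set T.V) : Set T.V → ℕ → Set T.V → Prop
  | done (Q : Set T.V) : Serve t B Q 0 Q
  | skip (Q Q' : Set T.V) (n : ℕ) : children T B Q = ∅ → Serve t B Q n Q' →
      Serve t B Q (n + 1) Q'
  | place (Q Q' : Set T.V) (n : ℕ) (v : T.V) : (children T B Q).Nonempty → Choice T t B Q v →
      Serve t B (insert v Q) n Q' → Serve t B Q (n + 1) Q'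

/-- The strategy follows the two-firefighter algorithm on `T`. -/
def IsTwoFirefighterOn (A : Strategy T) : Prop :=
  ∀ f t, Serve T t (burnt T (A.play f) t) (protectedBy T (A.play f) t) (f t)
    (protectedBy T (A.play f) (t + 1))

end TwoFirefighters

/-- `A` follows the two-firefighter algorithm (ties are broken arbitrarily). -/
def IsTwoFirefighterAlgorithm (A : OnlineAlgorithm) : Prop := ∀ T, IsTwoFirefighterOn T (A T)

/-! ### The trees `W_{k,l,m}` -/

/-- The vertices of `W_{k,l,m}`, for `1 ≤ k`, `2 ≤ l`, `1 ≤ m` and `k ∣ m - 1`: a root `r`; a branch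
with `l` vertices, consisting of `x`, its only child `center` and the `l - 2` leaves below `center`;
a branch with `m` vertices, consisting of `y` and `k` chains of equal length below `y`. -/
inductive WVertex (k l m : ℕ) : Type
  | r | x | center | leaf (i : Fin (l - 2)) | y | chain (i : Fin k) (j : Fin ((m - 1) / k))
  deriving DecidableEq, Fintype

/-- The parent of a vertex (and `r` for the root). -/
def WVertex.parent {k l m : ℕ} : WVertex k l m → WVertex k l m
  | r => r
  | x => r
  | center => x
  | leaf _ => center
  | y => r
  | chain _ ⟨0, _⟩ => y
  | chain i ⟨j + 1, h⟩ => chain i ⟨j, by omega⟩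

/-- The depth of a vertex. -/
def WVertex.depth {k l m : ℕ} : WVertex k l m → ℕ
  | r => 0
  | x => 1
  | center => 2
  | leaf _ => 3
  | y => 1
  | chain _ j => j + 2

theorem WVertex.depth_parent {k l m : ℕ} (v : WVertex k l m) (hv : v ≠ .r) :
    v.parent.depth < v.depth := by
  match v with
  | r => exact absurd rfl hv
  | x => simp [parent, depth]
  | center => simp [parent, depth]
  | leaf _ => simp [parent, depth]
  | y => simp [parent, depth]
  | chain _ ⟨0, _⟩ => simp [parent, depth]
  | chain i ⟨j + 1, h⟩ => simp [parent, depth]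

/-- Each vertex is joined to its parent. -/
def WGraph (k l m : ℕ) : SimpleGraph (WVertex k l m) :=
  SimpleGraph.fromRel fun u v => u.parent = v

theorem WGraph_isTree (k l m : ℕ) : (WGraph k l m).IsTree := by
  have hne : ∀ v : WVertex k l m, v ≠ .r → v ≠ v.parent := by
    intro v hv h
    have := WVertex.depth_parent v hv
    rw [← h] at this
    exact lt_irrefl _ this
  have hreach : ∀ (n : ℕ) (v : WVertex k l m), v.depth = n → (WGraph k l m).Reachable v .r := by
    intro n
    induction n using Nat.strong_induction_on with
    | _ n ih =>
      intro v hn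
      by_cases hv : v = .r
      · rw [hv]
      · have hadj : (WGraph k l m).Adj v v.parent := by
          simp only [WGraph, SimpleGraph.fromRel_adj]
          exact ⟨hne v hv, Or.inl trivial⟩
        exact hadj.reachable.trans
          (ih _ (hn ▸ WVertex.depth_parent v hv) v.parent rfl)
  have hconn : (WGraph k l m).Connected :=
    { preconnected := fun u v => (hreach _ u rfl).trans (hreach _ v rfl).symm
      nonempty := ⟨.r⟩ }
  rw [SimpleGraph.isTree_iff_connected_and_card]
  refine ⟨hconn, le_antisymm ?_ hconn.card_vert_le_card_edgeSet_add_one⟩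
  have hsub : (WGraph k l m).edgeSet ⊆
      (fun v : WVertex k l m => s(v, v.parent)) '' {v | v ≠ .r} := by
    intro e
    induction e using Sym2.ind with
    | _ u v =>
      intro he
      rw [SimpleGraph.mem_edgeSet, WGraph, SimpleGraph.fromRel_adj] at he
      obtain ⟨huv, h | h⟩ := he
      · refine ⟨u, ?_, by simp [h]⟩
        rintro rfl
        exact huv h
      · refine ⟨v, ?_, by simp [h, Sym2.eq_swap]⟩
        rintro rfl
        exact huv h.symm
  have h1 : (WGraph k l m).edgeSet.ncard ≤ ({v : WVertex k l m | v ≠ .r}).ncard :=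
    (Set.ncard_le_ncard hsub (Set.toFinite _)).trans (Set.ncard_image_le (Set.toFinite _))
  have h2 : ({v : WVertex k l m | v ≠ .r}).ncard < Nat.card (WVertex k l m) := by
    rw [← Set.ncard_univ]
    exact Set.ncard_lt_ncard ⟨Set.subset_univ _, fun h => h (Set.mem_univ WVertex.r) rfl⟩
      (Set.toFinite _)
  have h3 : Nat.card (WGraph k l m).edgeSet = (WGraph k l m).edgeSet.ncard := rfl
  omega

/-- The rooted tree `W_{k,l,m}`. -/
def W (k l m : ℕ) : RootedTree where
  V := WVertex k l m
  graph := WGraph k l m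
  isTree := WGraph_isTree k l m
  root := .r

end

end Firefighter

/-! On a tree the fire reaches a vertex at the time given by its level, unless the vertex or one of
its ancestors has been protected by then. The value of a play is therefore the size of a union of
subtrees, those of the vertices protected ahead of the fire (`Legal.saved_eq`), and everything
becomes a comparison of weights. A vertex protected in turn `t` ahead of the fire may be replaced by
its ancestor of level `t + 1`, which only enlarges its subtree.

Greedy, `IsGreedyOn.saved_le_two_mul`: split the vertices protected by an arbitrary play into those
inside the region saved by greedy and the others. The former contribute at most that region. The
latter, moved up to level `t + 1`, were admissible for greedy in the same turn, so greedy's choice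
weighed at least as much; greedy's subtrees being disjoint, these contribute at most its value once
more.

Two firefighters, `saved_le_of_successive`: only arrivals in two different turns need an argument.
The opponent gains on the algorithm only by taking a second vertex inside the subtree already
secured. If the heaviest vertex `a` was chosen, the test bounds exactly this loss. If `b` was
chosen, the level at which the test failed either precedes the second placement, and then `b` alone
suffices, or comes no earlier, and then a heavy vertex below `a` is still available.

Upper bounds, `treeValue_W_le`: on `W k l m` the first move commits to a side. A player on the `x`
side is punished by silence, or by one firefighter in the second turn, when the star is still whole
but `y` has already split into thin chains. A player on the `y` side is punished by firefighters in
the third turn, when the star has dissolved into leaves but the chains are almost intact. Long and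
numerous chains push the ratio to `1 / 2`, a single chain with consecutive Fibonacci numbers to `1 /
φ`, and `W 4 901 1001` below `1 / φ`. Since `alpha` is antitone, these values give all the bounds.
-/

namespace Firefighter

/-! ### The ancestor order and subtree weights -/

section RootedStructure

variable {T : RootedTree}

theorem level_root : level T T.root = 0 := SimpleGraph.dist_self

theorem eq_root_of_level_eq_zero {v : T.V} (h : level T v = 0) : v = T.root :=
  (T.isTree.1.dist_eq_zero_iff.1 h).symm

theorem level_eq_of_adj {u v : T.V} (h : T.graph.Adj u v) :
    level T v = level T u + 1 ∨ level T u = level T v + 1 := by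
  rcases T.isTree.dist_eq_dist_add_one_of_adj T.root h with h | h
  · exact Or.inr h
  · exact Or.inl h

/-- The last step of a shortest walk from `u` to `v`. -/
theorem exists_adj_dist_eq {u v : T.V} {n : ℕ} (h : T.graph.dist u v = n + 1) :
    ∃ w, T.graph.Adj w v ∧ T.graph.dist u w = n := by
  obtain ⟨p, hp⟩ := T.isTree.1.exists_walk_length_eq_dist v u
  rw [SimpleGraph.dist_comm, h] at hp
  cases p with
  | nil => simp at hp
  | @cons _ w _ hvw q =>
    refine ⟨w, hvw.symm, ?_⟩
    have h1 : T.graph.dist w u ≤ q.length := SimpleGraph.dist_le q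
    have h2 := T.isTree.1.dist_triangle (u := u) (v := w) (w := v)
    have h3 : T.graph.dist w v = 1 := SimpleGraph.dist_eq_one_iff_adj.2 hvw.symm
    rw [SimpleGraph.Walk.length_cons] at hp
    rw [SimpleGraph.dist_comm] at h1
    omega

/-- A vertex has only one neighbour closer to the root. -/
theorem eq_of_adj_of_level {u w v : T.V} (hu : T.graph.Adj u v) (hw : T.graph.Adj w v)
    (hlu : level T v = level T u + 1) (hlw : level T v = level T w + 1) : u = w := by
  have key : ∀ x, T.graph.Adj x v → level T v = level T x + 1 →
      ∃ p : T.graph.Walk T.root v, p.IsPath ∧ p.penultimate = x := by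
    intro x hx hl
    obtain ⟨p, hp⟩ := T.isTree.1.exists_walk_length_eq_dist T.root x
    refine ⟨p.concat hx, SimpleGraph.Walk.isPath_of_length_eq_dist _ ?_, by simp⟩
    rw [SimpleGraph.Walk.length_concat, hp]
    exact hl.symm
  obtain ⟨p, hp, rfl⟩ := key u hu hlu
  obtain ⟨q, hq, rfl⟩ := key w hw hlw
  rw [(T.isTree.existsUnique_path _ _).unique hp hq]

theorem AncestorOrEq.refl (v : T.V) : AncestorOrEq T v v := by simp [AncestorOrEq]

theorem AncestorOrEq.level_le {u v : T.V} (h : AncestorOrEq T u v) : level T u ≤ level T v := by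
  unfold AncestorOrEq at h; omega

theorem level_le_add_dist (u v : T.V) : level T v ≤ level T u + T.graph.dist u v :=
  T.isTree.1.dist_triangle

theorem AncestorOrEq.trans {u v w : T.V} (h : AncestorOrEq T u v) (h' : AncestorOrEq T v w) :
    AncestorOrEq T u w := by
  have h1 := T.isTree.1.dist_triangle (u := u) (v := v) (w := w)
  have h2 := level_le_add_dist (T := T) u w
  unfold AncestorOrEq at *
  omega

theorem AncestorOrEq.eq_of_level {u v : T.V} (h : AncestorOrEq T u v)
    (hl : level T v ≤ level T u) : u = v := by
  unfold AncestorOrEq at h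
  exact T.isTree.1.dist_eq_zero_iff.1 (by omega)

theorem AncestorOrEq.of_adj {u v : T.V} (h : T.graph.Adj u v) (hl : level T v = level T u + 1) :
    AncestorOrEq T u v := by
  rw [AncestorOrEq, SimpleGraph.dist_eq_one_iff_adj.2 h, hl]

theorem AncestorOrEq.level_lt {u v : T.V} (h : AncestorOrEq T u v) (hne : u ≠ v) :
    level T u < level T v := by
  by_contra hl
  exact hne (h.eq_of_level (not_lt.1 hl))

/-- A proper ancestor of `v` is an ancestor of the parent of `v`. -/
theorem AncestorOrEq.of_parent {u v w : T.V} (h : AncestorOrEq T u v) (hne : u ≠ v)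
    (hw : T.graph.Adj w v) (hl : level T v = level T w + 1) : AncestorOrEq T u w := by
  have hpos := h.level_lt hne
  obtain ⟨n, hn⟩ : ∃ n, T.graph.dist u v = n + 1 :=
    ⟨T.graph.dist u v - 1, by unfold AncestorOrEq at h; omega⟩
  obtain ⟨x, hx, hxn⟩ := exists_adj_dist_eq hn
  have h1 := level_le_add_dist (T := T) u x
  have h2 : level T v = level T x + 1 := by
    have := level_eq_of_adj hx
    unfold AncestorOrEq at h
    omega
  obtain rfl := eq_of_adj_of_level hx hw h2 hl
  unfold AncestorOrEq at *
  omega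

theorem exists_parent {v : T.V} {n : ℕ} (h : level T v = n + 1) :
    ∃ w, T.graph.Adj w v ∧ level T w = n := exists_adj_dist_eq h

/-- Climbing from `v` by unique parents passes through every ancestor of `v`, so the ancestors form
a chain ordered by level. -/
theorem AncestorOrEq.comparable {u u' v : T.V} (h : AncestorOrEq T u v) (h' : AncestorOrEq T u' v)
    (hl : level T u ≤ level T u') : AncestorOrEq T u u' := by
  induction hn : level T v generalizing v with
  | zero =>
    have h1 : u' = v := h'.eq_of_level (by omega)
    rwa [h1]
  | succ n ih =>
    by_cases h1 : u' = v
    · rwa [h1]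
    have h2 : u ≠ v := by
      rintro rfl
      exact h1 (h'.eq_of_level hl)
    obtain ⟨w, hw, hwl⟩ := exists_parent hn
    exact ih (h.of_parent h2 hw (by omega)) (h'.of_parent h1 hw (by omega)) hwl

theorem AncestorOrEq.unique {u u' v : T.V} (h : AncestorOrEq T u v) (h' : AncestorOrEq T u' v)
    (hl : level T u = level T u') : u = u' :=
  (h.comparable h' hl.le).eq_of_level hl.ge

theorem exists_ancestor_level {v : T.V} {j : ℕ} (h : j ≤ level T v) :
    ∃ u, AncestorOrEq T u v ∧ level T u = j := by
  induction hn : level T v generalizing v with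
  | zero => exact ⟨v, .refl v, by omega⟩
  | succ n ih =>
    by_cases h1 : j = n + 1
    · exact ⟨v, .refl v, by omega⟩
    obtain ⟨w, hw, hwl⟩ := exists_parent hn
    obtain ⟨u, hu, hul⟩ := ih (v := w) (by omega) hwl
    exact ⟨u, hu.trans (.of_adj hw (by omega)), hul⟩

/-- The vertices below `v`, including `v`. -/
def below (T : RootedTree) (v : T.V) : Set T.V := {u | AncestorOrEq T v u}

theorem ncard_below (v : T.V) : (below T v).ncard = weight T v := rfl

theorem below_subset {u v : T.V} (h : AncestorOrEq T u v) : below T v ⊆ below T u :=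
  fun _ hw => h.trans hw

theorem weight_mono {u v : T.V} (h : AncestorOrEq T u v) : weight T v ≤ weight T u :=
  Set.ncard_le_ncard (below_subset h) (Set.toFinite _)

theorem weight_pos (v : T.V) : 0 < weight T v :=
  (Set.ncard_pos (Set.toFinite _)).2 ⟨v, .refl v⟩

theorem disjoint_below {u v : T.V} (h : ¬ AncestorOrEq T u v) (h' : ¬ AncestorOrEq T v u) :
    Disjoint (below T u) (below T v) := by
  rw [Set.disjoint_left]
  intro w hu hv
  rcases le_total (level T u) (level T v) with hl | hl
  · exact h (AncestorOrEq.comparable hu hv hl)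
  · exact h' (AncestorOrEq.comparable hv hu hl)

theorem level_le_height (v : T.V) : level T v ≤ height T :=
  Finset.le_sup (f := level T) (Finset.mem_univ v)

theorem le_maxWeightBelow {u v : T.V} {j : ℕ} (h : AncestorOrEq T u v) (hj : level T v = j) :
    weight T v ≤ maxWeightBelow T u j := by
  classical
  exact Finset.le_sup (f := weight T) (by simp [h, hj])

theorem maxWeightBelow_le {u : T.V} {j n : ℕ}
    (h : ∀ v, AncestorOrEq T u v → level T v = j → weight T v ≤ n) : maxWeightBelow T u j ≤ n := by
  classical
  refine Finset.sup_le fun v hv => ?_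
  rw [Finset.mem_filter] at hv
  exact h v hv.2.1 hv.2.2

theorem maxWeightBelow_anti (u : T.V) {i j : ℕ} (hi : level T u ≤ i) (h : i ≤ j) :
    maxWeightBelow T u j ≤ maxWeightBelow T u i := by
  refine maxWeightBelow_le fun v hv hj => ?_
  obtain ⟨w, hw, hwi⟩ := exists_ancestor_level (T := T) (v := v) (j := i) (by omega)
  exact (weight_mono hw).trans (le_maxWeightBelow (hv.comparable hw (by omega)) hwi)

end RootedStructure

/-! ### Burning and saved vertices in terms of protected ancestors -/

section Play

variable {T : RootedTree} {p : ℕ → Finset T.V} {f : ℕ → ℕ}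

theorem protectedBy_mono {m n : ℕ} (h : m ≤ n) : protectedBy T p m ⊆ protectedBy T p n :=
  fun _ ⟨t, ht, hv⟩ => ⟨t, ht.trans_le h, hv⟩

theorem protectedBy_succ (n : ℕ) : protectedBy T p (n + 1) = protectedBy T p n ∪ p n := by
  ext v
  simp only [protectedBy, Set.mem_ofPred_eq, Set.mem_union, Finset.mem_coe]
  constructor
  · rintro ⟨t, ht, hv⟩
    rcases Nat.lt_succ_iff_lt_or_eq.1 ht with h | rfl
    · exact Or.inl ⟨t, h, hv⟩
    · exact Or.inr hv
  · rintro (⟨t, ht, hv⟩ | hv)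
    · exact ⟨t, by omega, hv⟩
    · exact ⟨n, by omega, hv⟩

theorem burnt_mono {m n : ℕ} (h : m ≤ n) : burnt T p m ⊆ burnt T p n :=
  monotone_nat_of_le_succ (f := burnt T p) (fun _ => Set.subset_union_left) h

theorem level_le_of_mem_burnt {n : ℕ} {v : T.V} (h : v ∈ burnt T p n) : level T v ≤ n := by
  induction n generalizing v with
  | zero =>
    obtain rfl : v = T.root := h
    exact level_root.le
  | succ n ih =>
    rcases h with h | ⟨⟨u, hu, huv⟩, -⟩
    · exact (ih h).trans n.le_succ
    · have := ih hu
      have := level_eq_of_adj huv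
      omega

theorem mem_burnt_level {v : T.V}
    (h : ∀ u, AncestorOrEq T u v → u ∉ protectedBy T p (level T v)) :
    v ∈ burnt T p (level T v) := by
  induction hn : level T v generalizing v with
  | zero =>
    rw [eq_root_of_level_eq_zero hn]
    exact rfl
  | succ n ih =>
    obtain ⟨w, hw, hwl⟩ := exists_parent hn
    refine Or.inr ⟨⟨w, ih (fun u hu hu' => ?_) hwl, hw⟩, hn ▸ h v (.refl v)⟩
    refine h u (hu.trans (.of_adj hw (by omega))) (protectedBy_mono ?_ hu')
    omega

theorem Legal.notMem_burnt (hp : Legal T f p) {t : ℕ} {u : T.V} (hu : u ∈ p t) (n : ℕ) :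
    u ∉ burnt T p n := by
  induction n with
  | zero => exact fun h => ((hp t).2 u hu).1 (burnt_mono (Nat.zero_le t) h)
  | succ n ih =>
    rcases le_or_gt (n + 1) t with h | h
    · exact fun h' => ((hp t).2 u hu).1 (burnt_mono h h')
    · rintro (h' | ⟨-, h'⟩)
      · exact ih h'
      · exact h' ⟨t, h, hu⟩

/-- Every neighbour of a vertex properly below `u` is again at or below `u`, so fire could enter the
subtree only through `u`. The turn `n` may precede `t`: legality makes `u` unburnt at all times. -/
theorem Legal.notMem_burnt_of_ancestor (hp : Legal T f p) {t : ℕ} {u v : T.V} (hu : u ∈ p t)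
    (huv : AncestorOrEq T u v) (n : ℕ) : v ∉ burnt T p n := by
  induction n generalizing v with
  | zero =>
    intro h
    obtain rfl : v = T.root := h
    have h1 := huv.level_le
    rw [level_root] at h1
    obtain rfl := eq_root_of_level_eq_zero (Nat.le_zero.1 h1)
    exact hp.notMem_burnt hu 0 rfl
  | succ n ih =>
    intro h
    by_cases hne : u = v
    · exact hp.notMem_burnt hu (n + 1) (hne ▸ h)
    rcases h with h | ⟨⟨w, hw, hwv⟩, -⟩
    · exact ih huv h
    · rcases level_eq_of_adj hwv with hl | hl
      · exact ih (huv.of_parent hne hwv hl) hw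
      · exact ih (huv.trans (.of_adj hwv.symm hl)) hw

/-- The vertices below one that is protected in turn `t`, before the fire could have reached it. -/
def covered (T : RootedTree) (p : ℕ → Finset T.V) (t : ℕ) : Set T.V :=
  {v | ∃ u ∈ p t, t < level T u ∧ AncestorOrEq T u v}

/-- The topmost protected ancestor `w` of `v` was protected ahead of the fire: otherwise the path to
`w` was unprotected when the fire came down it, and `w` was burning before its own turn. Placements
inside an already safe subtree may thus be ignored. -/
theorem Legal.exists_mem_covered (hp : Legal T f p) {s : ℕ} {u v : T.V} (hu : u ∈ p s)
    (huv : AncestorOrEq T u v) : ∃ t, v ∈ covered T p t := by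
  classical
  have hex : ∃ n, ∃ t, ∃ w ∈ p t, AncestorOrEq T w v ∧ level T w = n := ⟨_, s, u, hu, huv, rfl⟩
  obtain ⟨t, w, hw, hwv, hl⟩ := Nat.find_spec hex
  refine ⟨t, w, hw, ?_, hwv⟩
  by_contra hlt
  rw [not_lt] at hlt
  refine ((hp t).2 w hw).1 (burnt_mono hlt (mem_burnt_level fun x hx hx' => ?_))
  by_cases hxw : x = w
  · exact ((hp t).2 w hw).2 (protectedBy_mono hlt (hxw ▸ hx'))
  · obtain ⟨t', -, ht'⟩ := hx'
    exact Nat.find_min hex (hl ▸ hx.level_lt hxw) ⟨t', x, ht', hx.trans hwv, rfl⟩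

theorem Legal.mem_burnt_iff (hp : Legal T f p) {n : ℕ} {v : T.V} :
    v ∈ burnt T p n ↔ level T v ≤ n ∧ ∀ u, AncestorOrEq T u v → u ∉ protectedBy T p n := by
  constructor
  · intro h
    refine ⟨level_le_of_mem_burnt h, ?_⟩
    rintro u hu ⟨t, -, ht⟩
    exact hp.notMem_burnt_of_ancestor ht hu n h
  · rintro ⟨hl, h⟩
    exact burnt_mono hl (mem_burnt_level fun u hu hu' => h u hu (protectedBy_mono hl hu'))

theorem Legal.setOf_never_burnt (hp : Legal T f p) :
    {v : T.V | ∀ n, v ∉ burnt T p n} = ⋃ t, covered T p t := by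
  ext v
  rw [Set.mem_iUnion, Set.mem_ofPred_eq]
  constructor
  · intro h
    have h1 := h (level T v)
    rw [hp.mem_burnt_iff] at h1
    push Not at h1
    obtain ⟨u, hu, t, -, ht⟩ := h1 le_rfl
    exact hp.exists_mem_covered ht hu
  · rintro ⟨t, u, hu, -, huv⟩ n
    exact hp.notMem_burnt_of_ancestor hu huv n

theorem Legal.saved_eq (hp : Legal T f p) : saved T p = (⋃ t, covered T p t).ncard := by
  rw [saved, hp.setOf_never_burnt]

theorem Legal.ncard_le_saved (hp : Legal T f p) {S : Set T.V}
    (hS : ∀ v ∈ S, ∃ t, ∃ u ∈ p t, AncestorOrEq T u v) : S.ncard ≤ saved T p := by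
  rw [hp.saved_eq]
  refine Set.ncard_le_ncard (fun v hv => ?_) (Set.toFinite _)
  obtain ⟨t, u, hu, huv⟩ := hS v hv
  exact Set.mem_iUnion.2 (hp.exists_mem_covered hu huv)

theorem Legal.saved_le (hp : Legal T f p) {S : Set T.V}
    (hS : ∀ t, ∀ u ∈ p t, t < level T u → below T u ⊆ S) : saved T p ≤ S.ncard := by
  rw [hp.saved_eq]
  refine Set.ncard_le_ncard (Set.iUnion_subset fun t => ?_) (Set.toFinite _)
  rintro v ⟨u, hu, hl, huv⟩
  exact hS t u hu hl huv

theorem Legal.eq_empty (hp : Legal T f p) {t : ℕ} (ht : f t = 0) : p t = ∅ :=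
  Finset.card_eq_zero.1 (Nat.le_zero.1 (ht ▸ (hp t).1))

theorem legal_of_level (h : ∀ t, (p t).card ≤ f t)
    (hl : ∀ t, ∀ v ∈ p t, t < level T v ∧ v ∉ protectedBy T p t) : Legal T f p :=
  fun t => ⟨h t, fun v hv =>
    ⟨fun hb => (level_le_of_mem_burnt hb).not_gt (hl t v hv).1, (hl t v hv).2⟩⟩

theorem legal_empty (f : ℕ → ℕ) : Legal T f fun _ => ∅ := fun t => by simp

instance : Nonempty (Strategy T) := ⟨⟨fun _ _ => ∅, legal_empty, fun _ _ _ _ => rfl⟩⟩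

theorem bddAbove_values (f : ℕ → ℕ) : BddAbove {s : ℕ | ∃ p, Legal T f p ∧ saved T p = s} := by
  refine ⟨Nat.card T.V, ?_⟩
  rintro s ⟨p, -, rfl⟩
  rw [← Set.ncard_univ]
  exact Set.ncard_le_ncard (Set.subset_univ _) (Set.toFinite _)

theorem Legal.saved_le_offlineOpt (hp : Legal T f p) : saved T p ≤ offlineOpt T f :=
  le_csSup (bddAbove_values f) ⟨p, hp, rfl⟩

theorem exists_saved_eq_offlineOpt (T : RootedTree) (f : ℕ → ℕ) :
    ∃ p, Legal T f p ∧ saved T p = offlineOpt T f :=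
  Nat.sSup_mem (s := {s : ℕ | ∃ p, Legal T f p ∧ saved T p = s})
    ⟨_, _, legal_empty f, rfl⟩ (bddAbove_values f)

end Play

/-! ### Bounding ratios, tree values and `alpha` -/

section Ratio

variable {T : RootedTree}

theorem ratio_nonneg (A : Strategy T) (f : ℕ → ℕ) : 0 ≤ ratio T A f := by
  unfold ratio; split_ifs <;> positivity

theorem ratio_le_one (A : Strategy T) (f : ℕ → ℕ) : ratio T A f ≤ 1 := by
  unfold ratio
  split_ifs
  · exact le_rfl
  · exact div_le_one_of_le₀ (mod_cast (A.legal f).saved_le_offlineOpt) (by positivity)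

theorem le_ratio {A : Strategy T} {f : ℕ → ℕ} {γ : ℝ} (hγ : γ ≤ 1)
    (h : ∀ q, Legal T f q → γ * saved T q ≤ saved T (A.play f)) : γ ≤ ratio T A f := by
  unfold ratio
  split_ifs with h0
  · exact hγ
  · obtain ⟨q, hq, hs⟩ := exists_saved_eq_offlineOpt T f
    rw [le_div_iff₀ (by positivity), ← hs]
    exact h q hq

theorem ratio_le {A : Strategy T} {f : ℕ → ℕ} {q : ℕ → Finset T.V} (hq : Legal T f q) {m n : ℕ}
    (hm : saved T (A.play f) ≤ m) (hn : n ≤ saved T q) (hn0 : 0 < n) :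
    ratio T A f ≤ (m : ℝ) / n := by
  have h1 := hn.trans hq.saved_le_offlineOpt
  unfold ratio
  rw [if_neg (by omega)]
  gcongr

theorem bddBelow_ratio (A : Strategy T) (k : ℕ) :
    BddBelow (Set.range fun f : atMost k => ratio T A f) :=
  ⟨0, by rintro _ ⟨f, rfl⟩; exact ratio_nonneg A f⟩

instance (k : ℕ) : Nonempty (atMost k) := ⟨⟨fun _ => 0, fun n => by simp⟩⟩

theorem iInf_ratio_le {A : Strategy T} {k : ℕ} {f : ℕ → ℕ} (hf : f ∈ atMost k) :
    ⨅ f : atMost k, ratio T A f ≤ ratio T A f :=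
  ciInf_le (bddBelow_ratio A k) ⟨f, hf⟩

theorem bddAbove_iInf_ratio (T : RootedTree) (k : ℕ) :
    BddAbove (Set.range fun A : Strategy T => ⨅ f : atMost k, ratio T A f) := by
  refine ⟨1, ?_⟩
  rintro _ ⟨A, rfl⟩
  exact (iInf_ratio_le (f := fun _ => 0) fun n => by simp).trans (ratio_le_one _ _)

theorem treeValue_le {k : ℕ} {c : ℝ} (h : ∀ A : Strategy T, ∃ f ∈ atMost k, ratio T A f ≤ c) :
    treeValue k T ≤ c := by
  refine ciSup_le fun A => ?_
  obtain ⟨f, hf, hc⟩ := h A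
  exact (iInf_ratio_le hf).trans hc

theorem le_treeValue {k : ℕ} {c : ℝ} (A : Strategy T) (h : ∀ f ∈ atMost k, c ≤ ratio T A f) :
    c ≤ treeValue k T :=
  le_ciSup_of_le (bddAbove_iInf_ratio T k) A (le_ciInf fun f => h f f.2)

theorem treeValue_nonneg (k : ℕ) (T : RootedTree) : 0 ≤ treeValue k T :=
  le_treeValue (Classical.arbitrary _) fun _ _ => ratio_nonneg _ _

instance : Nonempty RootedTree := ⟨W 1 1 1⟩

theorem alpha_le_treeValue (k : ℕ) (T : RootedTree) : alpha k ≤ treeValue k T :=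
  ciInf_le ⟨0, by rintro _ ⟨T, rfl⟩; exact treeValue_nonneg k T⟩ T

theorem atMost_mono {k l : ℕ} (h : k ≤ l) : atMost k ⊆ atMost l := fun _ hf n => (hf n).trans h

/-- More firefighters give the adversary more sequences to choose from. -/
theorem treeValue_anti (T : RootedTree) {k l : ℕ} (h : k ≤ l) :
    treeValue l T ≤ treeValue k T :=
  ciSup_le fun A => le_treeValue A fun _ hf => iInf_ratio_le (atMost_mono h hf)

theorem alpha_anti {k l : ℕ} (h : k ≤ l) : alpha l ≤ alpha k :=
  le_ciInf fun T => (alpha_le_treeValue l T).trans (treeValue_anti T h)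

theorem Competitive.le_alpha {A : OnlineAlgorithm} {F : Set (ℕ → ℕ)} {γ : ℝ}
    (h : Competitive A F γ) {k : ℕ} (hF : atMost k ⊆ F) : γ ≤ alpha k :=
  le_ciInf fun T => le_treeValue (A T) fun f hf => h.2.2 T f (hF hf)

end Ratio

/-! ### Strategies from history-dependent rules -/

section Construction

variable {T : RootedTree}

/-- A rule `R` for the moves that depends only on the past, always admits a move and permits only
legal moves is followed by some strategy. -/
theorem exists_strategy (R : (ℕ → Finset T.V) → ℕ → ℕ → Finset T.V → Prop)
    (hcongr : ∀ p q t n X, (∀ s < t, p s = q s) → R p t n X → R q t n X)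
    (hex : ∀ (f : ℕ → ℕ) p t, (∀ s < t, R p s (f s) (p s)) → ∃ X, R p t (f t) X)
    (hlegal : ∀ f p, (∀ t, R p t (f t) (p t)) → Legal T f p) :
    ∃ A : Strategy T, ∀ f t, R (A.play f) t (f t) (A.play f t) := by
  classical
  let move : (ℕ → Finset T.V) → ℕ → ℕ → Finset T.V := fun p t n =>
    if h : ∃ X, R p t n X then h.choose else ∅
  have hmove : ∀ {p t n}, (∃ X, R p t n X) → R p t n (move p t n) := by
    intro p t n h
    simp only [move, dif_pos h]
    exact h.choose_spec
  -- `hist f n` is the play truncated after `n` turns, with empty moves from then on. It agrees with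
  -- the full play on the past, which by `hcongr` is all that `R` sees.
  let hist : (ℕ → ℕ) → ℕ → ℕ → Finset T.V := fun f n =>
    n.rec (fun _ => ∅) fun t p => Function.update p t (move p t (f t))
  have hsucc : ∀ f t, hist f (t + 1) = Function.update (hist f t) t (move (hist f t) t (f t)) :=
    fun _ _ => rfl
  let play : (ℕ → ℕ) → ℕ → Finset T.V := fun f t => hist f (t + 1) t
  have hplay : ∀ f t, play f t = move (hist f t) t (f t) := fun f t => by
    simp only [play, hsucc, Function.update_self]
  have hhist : ∀ f t s, s < t → hist f t s = play f s := by
    intro f t s hst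
    induction t with
    | zero => omega
    | succ t ih =>
      rcases Nat.lt_succ_iff_lt_or_eq.1 hst with h | rfl
      · rw [hsucc, Function.update_of_ne h.ne, ih h]
      · rfl
  have hR : ∀ f t, R (play f) t (f t) (play f t) := by
    intro f t
    induction t using Nat.strong_induction_on with
    | _ t ih =>
      refine hcongr (hist f t) _ _ _ _ (hhist f t) ?_
      rw [hplay]
      obtain ⟨X, hX⟩ := hex f (play f) t ih
      exact hmove ⟨X, hcongr _ _ _ _ _ (fun s hs => (hhist f t s hs).symm) hX⟩
  refine ⟨⟨play, fun f => hlegal f _ (hR f), fun f g t hfg => ?_⟩, hR⟩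
  have : ∀ n ≤ t, hist f n = hist g n := by
    intro n hn
    induction n with
    | zero => rfl
    | succ n ih => rw [hsucc, hsucc, ih (by omega), hfg n (by omega)]
  rw [hplay, hplay, this t le_rfl, hfg t le_rfl]

end Construction

/-! ### The greedy algorithm -/

section GreedyAnalysis

variable {T : RootedTree}

theorem protectedBy_congr {p q : ℕ → Finset T.V} {t : ℕ} (h : ∀ s < t, p s = q s) :
    protectedBy T p t = protectedBy T q t := by
  ext v
  exact exists_congr fun s => and_congr_right fun hs => by rw [h s hs]

theorem exists_isGreedyOn (T : RootedTree) : ∃ A : Strategy T, IsGreedyOn T A := by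
  classical
  refine exists_strategy (fun p t n X => GreedyFeasible T p t n X ∧
      ∀ Y, GreedyFeasible T p t n Y → ∑ v ∈ Y, weight T v ≤ ∑ v ∈ X, weight T v) ?_ ?_ ?_
  · intro p q t n X hpq
    simp only [GreedyFeasible, protectedBy_congr hpq]
    exact id
  · intro f p t _
    obtain ⟨X, hX, hmax⟩ := Finset.exists_max_image
      (Finset.univ.filter (GreedyFeasible T p t (f t))) (fun X => ∑ v ∈ X, weight T v)
      ⟨∅, by simp [GreedyFeasible]⟩
    exact ⟨X, (Finset.mem_filter.1 hX).2, fun Y hY => hmax Y (by simp [hY])⟩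
  · intro f p hp
    refine legal_of_level (fun t => (hp t).1.1) fun t v hv => ?_
    have h1 := ((hp t).1.2 v hv).1
    refine ⟨by omega, ?_⟩
    rintro ⟨s, hs, hvs⟩
    have h2 := ((hp s).1.2 v hvs).1
    omega

theorem exists_isGreedy : ∃ A, IsGreedy A := by
  choose A hA using exists_isGreedyOn
  exact ⟨A, hA⟩

/-- The subtrees of the vertices protected by a greedy strategy are disjoint. -/
theorem IsGreedyOn.sum_weight_le {A : Strategy T} (hA : IsGreedyOn T A) (f : ℕ → ℕ) (n : ℕ) :
    ∑ t ∈ Finset.range n, ∑ v ∈ A.play f t, weight T v ≤ saved T (A.play f) := by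
  classical
  set p := A.play f
  have hlev : ∀ t, ∀ v ∈ p t, level T v = t + 1 := fun t v hv => ((hA f t).1.2 v hv).1
  have hanc : ∀ s t, ∀ u ∈ p s, ∀ v ∈ p t, u ≠ v → ¬ AncestorOrEq T u v := by
    intro s t u hu v hv hne h
    have h1 := h.level_lt hne
    rw [hlev s u hu, hlev t v hv] at h1
    exact ((hA f t).1.2 v hv).2 u h hne ⟨s, by omega, hu⟩
  rw [Finset.sum_sigma' (Finset.range n) p fun _ v => weight T v]
  have hcard : ∀ v : T.V, weight T v = (below T v).toFinset.card := fun v => by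
    rw [← ncard_below, Set.ncard_eq_toFinset_card']
  simp only [hcard]
  rw [← Finset.card_biUnion]
  · rw [← Set.ncard_coe_finset]
    refine (A.legal f).ncard_le_saved fun v hv => ?_
    simp only [Finset.coe_biUnion, Set.mem_iUnion] at hv
    obtain ⟨⟨t, u⟩, hu, huv⟩ := hv
    exact ⟨t, u, (Finset.mem_sigma.1 (Finset.mem_coe.1 hu)).2,
      (Set.mem_toFinset (s := below T u)).1 (Finset.mem_coe.1 huv)⟩
  · rintro ⟨s, u⟩ hu ⟨t, v⟩ hv hne
    rw [Finset.mem_coe, Finset.mem_sigma] at hu hv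
    have huv : u ≠ v := by
      rintro rfl
      have h1 := hlev s u hu.2
      have h2 := hlev t u hv.2
      obtain rfl : s = t := by omega
      exact hne rfl
    refine Set.disjoint_toFinset.2 ?_
    exact disjoint_below (hanc s t u hu.2 v hv.2 huv) (hanc t s v hv.2 u hu.2 huv.symm)

/-- Every play saves at most twice as many vertices as a greedy strategy. -/
theorem IsGreedyOn.saved_le_two_mul {A : Strategy T} (hA : IsGreedyOn T A) {f : ℕ → ℕ}
    {q : ℕ → Finset T.V} (hq : Legal T f q) : saved T q ≤ 2 * saved T (A.play f) := by
  classical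
  set p := A.play f
  -- The condition stands under the existential so that `choose` gives a total function; otherwise
  -- `u` is a dummy value.
  have hanc : ∀ (t : ℕ) (u : T.V), ∃ x, t < level T u → AncestorOrEq T x u ∧ level T x = t + 1 := by
    intro t u
    by_cases h : t < level T u
    · obtain ⟨x, hx⟩ := exists_ancestor_level (T := T) (v := u) (j := t + 1) h
      exact ⟨x, fun _ => hx⟩
    · exact ⟨u, fun h' => absurd h' h⟩
  choose g hg using hanc
  let G : Set T.V := ⋃ t, covered T p t
  let X : ℕ → Finset T.V := fun t =>
    ((q t).filter fun u => t < level T u ∧ u ∉ G).image (g t)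
  -- A greedy-protected ancestor of `g t u` would also be an ancestor of `u` and put `u` into `G`.
  have hX : ∀ t, GreedyFeasible T p t (f t) (X t) := by
    intro t
    refine ⟨(Finset.card_image_le.trans (Finset.card_filter_le _ _)).trans (hq t).1, ?_⟩
    intro x hx
    obtain ⟨u, hu, rfl⟩ := Finset.mem_image.1 hx
    obtain ⟨-, hl, hG⟩ := Finset.mem_filter.1 hu
    obtain ⟨h1, h2⟩ := hg t u hl
    refine ⟨h2, ?_⟩
    rintro w hw - ⟨s, -, hs⟩
    exact hG (Set.mem_iUnion.2 ((A.legal f).exists_mem_covered hs (hw.trans h1)))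
  let I : Finset (Σ _ : ℕ, T.V) := (Finset.range (height T)).sigma X
  let U : Finset T.V := I.biUnion fun i => (below T i.2).toFinset
  have hU : U.card ≤ saved T p := by
    refine Finset.card_biUnion_le.trans ?_
    have hcard : ∀ v : T.V, (below T v).toFinset.card = weight T v := fun v => by
      rw [← ncard_below, Set.ncard_eq_toFinset_card']
    simp only [hcard]
    rw [Finset.sum_sigma]
    exact (Finset.sum_le_sum fun t _ => (hA f t).2 _ (hX t)).trans (hA.sum_weight_le f _)
  -- Both `G` and `U` have at most `saved T p` elements, which produces the factor two.
  have hle : saved T q ≤ (G ∪ (U : Set T.V)).ncard := by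
    refine hq.saved_le fun t u hu hl v hv => ?_
    by_cases hG : u ∈ G
    · left
      obtain ⟨s, w, hw, hwl, hwu⟩ := Set.mem_iUnion.1 hG
      exact Set.mem_iUnion.2 ⟨s, w, hw, hwl, hwu.trans hv⟩
    · right
      simp only [U, Finset.coe_biUnion, Set.mem_iUnion]
      obtain ⟨h1, -⟩ := hg t u hl
      refine ⟨⟨t, g t u⟩, ?_, Finset.mem_coe.2 (Set.mem_toFinset.2 (h1.trans hv))⟩
      simp only [I, Finset.mem_coe, Finset.mem_sigma, Finset.mem_range]
      exact ⟨hl.trans_le (level_le_height u),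
        Finset.mem_image_of_mem _ (Finset.mem_filter.2 ⟨hu, hl, hG⟩)⟩
  have h1 := hle.trans (Set.ncard_union_le _ _)
  have h2 : saved T p = G.ncard := (A.legal f).saved_eq
  rw [Set.ncard_coe_finset] at h1
  omega

theorem IsGreedy.competitive {A : OnlineAlgorithm} (hA : IsGreedy A) (F : Set (ℕ → ℕ)) :
    Competitive A F (1 / 2) := by
  refine ⟨by norm_num, by norm_num, fun T f _ => le_ratio (by norm_num) fun q hq => ?_⟩
  have h1 : (saved T q : ℝ) ≤ 2 * saved T ((A T).play f) := mod_cast (hA T).saved_le_two_mul hq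
  linarith

end GreedyAnalysis

/-! ### Existence of the two-firefighter algorithm -/

section TwoFirefightersExistence

variable {T : RootedTree}

theorem burnt_congr {p q : ℕ → Finset T.V} {t : ℕ} (h : ∀ s < t, p s = q s) :
    burnt T p t = burnt T q t := by
  induction t with
  | zero => rfl
  | succ t ih =>
    simp only [burnt, ih fun s hs => h s (by omega), protectedBy_congr h]

theorem exists_isTopPair {C : Set T.V} (hC : C.Nonempty) : ∃ a b, IsTopPair T C a b := by
  obtain ⟨a, ha, hmax⟩ := Set.exists_max_image C (weight T) (Set.toFinite _) hC
  by_cases h : (C \ {a}).Nonempty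
  · obtain ⟨b, hb, hbmax⟩ := Set.exists_max_image (C \ {a}) (weight T) (Set.toFinite _) h
    exact ⟨a, b, ha, hb.1, hmax, fun u hu hne => hbmax u ⟨hu, hne⟩,
      fun hab => absurd hab.symm hb.2⟩
  · have hCa : C = {a} := by
      rw [Set.not_nonempty_iff_eq_empty, Set.sdiff_eq_empty] at h
      exact h.antisymm (by simpa using ha)
    refine ⟨a, a, ha, ha, hmax, fun u hu hne => ?_, fun _ => hCa⟩
    rw [hCa] at hu
    exact absurd hu hne

theorem exists_choice (t : ℕ) {B Q : Set T.V} (h : (children T B Q).Nonempty) :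
    ∃ v ∈ children T B Q, Choice T t B Q v := by
  by_cases hQ : Q = ∅
  · obtain ⟨a, b, hab⟩ := exists_isTopPair h
    by_cases ht : FirstTest T t a b
    · exact ⟨a, hab.1, fun _ => ⟨a, b, hab, fun _ => rfl, fun h => absurd ht h⟩,
        fun h => absurd hQ h⟩
    · exact ⟨b, hab.2.1, fun _ => ⟨a, b, hab, fun h => absurd h ht, fun _ => rfl⟩,
        fun h => absurd hQ h⟩
  · obtain ⟨v, hv, hmax⟩ := Set.exists_max_image _ (weight T) (Set.toFinite _) h
    exact ⟨v, hv, fun h => absurd h hQ, fun _ => ⟨hv, hmax⟩⟩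

theorem exists_serve (t : ℕ) (B Q : Set T.V) (n : ℕ) :
    ∃ X : Finset T.V, Serve T t B Q n (Q ∪ X) ∧ X.card ≤ n ∧ ∀ v ∈ X, v ∉ B ∧ v ∉ Q := by
  classical
  induction n generalizing Q with
  | zero => exact ⟨∅, by simpa using Serve.done Q, by simp, by simp⟩
  | succ n ih =>
    rcases Set.eq_empty_or_nonempty (children T B Q) with hC | hC
    · obtain ⟨X, hX, hcard, hmem⟩ := ih Q
      exact ⟨X, .skip Q _ n hC hX, by omega, hmem⟩
    · obtain ⟨v, hv, hch⟩ := exists_choice t hC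
      obtain ⟨X, hX, hcard, hmem⟩ := ih (insert v Q)
      refine ⟨insert v X, .place Q _ n v hC hch ?_, ?_, ?_⟩
      · rwa [Finset.coe_insert, Set.union_insert, ← Set.insert_union]
      · exact (Finset.card_insert_le _ _).trans (by omega)
      · intro u hu
        rcases Finset.mem_insert.1 hu with rfl | hu
        · exact ⟨hv.1, hv.2.1⟩
        · exact ⟨(hmem u hu).1, fun h => (hmem u hu).2 (Set.mem_insert_of_mem _ h)⟩

theorem exists_isTwoFirefighterOn (T : RootedTree) :
    ∃ A : Strategy T, IsTwoFirefighterOn T A := by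
  obtain ⟨A, hA⟩ := exists_strategy (T := T) (fun p t n X =>
    Serve T t (burnt T p t) (protectedBy T p t) n (protectedBy T p t ∪ X) ∧ X.card ≤ n ∧
      ∀ v ∈ X, v ∉ burnt T p t ∧ v ∉ protectedBy T p t)
    (fun p q t n X hpq => by
      simp only [protectedBy_congr hpq, burnt_congr hpq]
      exact id)
    (fun f p t _ => exists_serve t _ _ _) (fun f p hp t => (hp t).2)
  refine ⟨A, fun f t => ?_⟩
  rw [protectedBy_succ]
  exact (hA f t).1

theorem exists_isTwoFirefighterAlgorithm : ∃ A, IsTwoFirefighterAlgorithm A := by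
  choose A hA using exists_isTwoFirefighterOn
  exact ⟨A, hA⟩

end TwoFirefightersExistence

/-! ### Competitiveness of the two-firefighter algorithm -/

section TwoFirefightersAnalysis

variable {T : RootedTree} {p q : ℕ → Finset T.V} {f : ℕ → ℕ}

theorem Serve.eq_of_zero {t : ℕ} {B Q Q' : Set T.V} (h : Serve T t B Q 0 Q') : Q' = Q := by
  cases h; rfl

theorem Serve.of_succ {t n : ℕ} {B Q Q' : Set T.V} (h : Serve T t B Q (n + 1) Q') :
    (children T B Q = ∅ ∧ Serve T t B Q n Q') ∨
      ∃ v, (children T B Q).Nonempty ∧ Choice T t B Q v ∧ Serve T t B (insert v Q) n Q' := by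
  cases h with
  | skip _ _ _ h1 h2 => exact Or.inl ⟨h1, h2⟩
  | place _ _ _ v h1 h2 h3 => exact Or.inr ⟨v, h1, h2, h3⟩

theorem children_insert (B Q : Set T.V) (c : T.V) :
    children T B (insert c Q) = children T B Q \ {c} := by
  ext v
  simp only [children, Set.mem_ofPred_eq, Set.mem_insert_iff, Set.mem_sdiff,
    Set.mem_singleton_iff]
  tauto

theorem Legal.mem_children_iff (hp : Legal T f p) {t : ℕ} {v : T.V} :
    v ∈ children T (burnt T p t) (protectedBy T p t) ↔
      level T v = t + 1 ∧ ∀ u, AncestorOrEq T u v → u ∉ protectedBy T p t := by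
  constructor
  · rintro ⟨hB, hQ, w, hw, hwv⟩
    have hw' := hp.mem_burnt_iff.1 hw
    have hanc : ∀ u, AncestorOrEq T u v → u ∉ protectedBy T p t := by
      intro u hu hup
      rcases level_eq_of_adj hwv with hl | hl
      · by_cases hne : u = v
        · exact hQ (hne ▸ hup)
        · exact hw'.2 u (hu.of_parent hne hwv hl) hup
      · exact hw'.2 u (hu.trans (.of_adj hwv.symm hl)) hup
    refine ⟨?_, hanc⟩
    have h1 : ¬ level T v ≤ t := fun h => hB (hp.mem_burnt_iff.2 ⟨h, hanc⟩)
    have := level_eq_of_adj hwv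
    omega
  · rintro ⟨hl, hanc⟩
    obtain ⟨w, hwv, hwl⟩ := exists_parent hl
    refine ⟨fun h => ?_, hanc v (.refl v), w, hp.mem_burnt_iff.2 ⟨hwl.le, fun u hu => ?_⟩, hwv⟩
    · have := level_le_of_mem_burnt h
      omega
    · exact hanc u (hu.trans (.of_adj hwv (by omega)))

theorem Legal.weight_le_saved (hp : Legal T f p) {n : ℕ} {c : T.V} (hc : c ∈ protectedBy T p n) :
    weight T c ≤ saved T p := by
  obtain ⟨t, -, ht⟩ := hc
  exact hp.ncard_le_saved fun v hv => ⟨t, c, ht, hv⟩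

theorem Legal.weight_add_weight_le_saved (hp : Legal T f p) {n : ℕ} {c z : T.V}
    (hc : c ∈ protectedBy T p n) (hz : z ∈ protectedBy T p n) (h : ¬ AncestorOrEq T c z)
    (h' : ¬ AncestorOrEq T z c) : weight T c + weight T z ≤ saved T p := by
  obtain ⟨t, -, ht⟩ := hc
  obtain ⟨s, -, hs⟩ := hz
  rw [← ncard_below, ← ncard_below,
    ← Set.ncard_union_eq (disjoint_below h h') (Set.toFinite _) (Set.toFinite _)]
  refine hp.ncard_le_saved ?_
  rintro v (hv | hv)
  · exact ⟨t, c, ht, hv⟩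
  · exact ⟨s, z, hs, hv⟩

theorem firstTest_self (t : ℕ) (a : T.V) : FirstTest T t a a := by
  intro j _ _
  have h1 : (0 : ℝ) < weight T a := mod_cast weight_pos a
  rw [div_self (by positivity), div_le_one (by positivity)]
  exact Real.one_lt_goldenRatio.le

/-- The first firefighter is placed on the heaviest vertex, or on the second one if the test
fails. -/
theorem Choice.first {t : ℕ} {B : Set T.V} {c : T.V} (h : Choice T t B ∅ c) :
    ∃ a b, IsTopPair T (children T B ∅) a b ∧
      (c = a ∧ FirstTest T t a b ∨ c = b ∧ a ≠ b ∧ ¬ FirstTest T t a b) := by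
  obtain ⟨a, b, hab, h1, h2⟩ := h.1 rfl
  refine ⟨a, b, hab, ?_⟩
  by_cases ht : FirstTest T t a b
  · exact Or.inl ⟨h1 ht, ht⟩
  · exact Or.inr ⟨h2 ht, fun h => ht (h ▸ firstTest_self t a), ht⟩

theorem exists_of_not_firstTest {t : ℕ} {a b : T.V} (h : ¬ FirstTest T t a b) :
    ∃ i, t + 2 ≤ i ∧ Real.goldenRatio * ((weight T a : ℝ) + maxWeightBelow T b i) <
      weight T b + maxWeightBelow T a i := by
  unfold FirstTest at h
  push Not at h
  obtain ⟨i, hi, -, hlt⟩ := h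
  refine ⟨i, hi, ?_⟩
  have h1 : (0 : ℝ) < weight T b := mod_cast weight_pos b
  rw [div_lt_div_iff₀ (by positivity) Real.goldenRatio_pos] at hlt
  linarith

theorem maxWeightBelow_le_weight (a : T.V) (i : ℕ) : maxWeightBelow T a i ≤ weight T a :=
  maxWeightBelow_le fun _ hv _ => weight_mono hv

/-- Failure at level `i` gives `φ w_a < w_b + w_a`, because no vertex below `a` outweighs `a`. Hence
`(φ - 1) w_a ≤ w_b`, and `φ (φ - 1) = 1`. This is the price of choosing `b`. -/
theorem weight_le_of_not_firstTest {t : ℕ} {a b : T.V} (h : ¬ FirstTest T t a b) :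
    (weight T a : ℝ) ≤ Real.goldenRatio * weight T b := by
  obtain ⟨i, -, hi⟩ := exists_of_not_firstTest h
  have h1 : (maxWeightBelow T a i : ℝ) ≤ weight T a := mod_cast maxWeightBelow_le_weight a i
  have h2 : (0 : ℝ) ≤ maxWeightBelow T b i := by positivity
  have h3 := Real.goldenRatio_sq
  have h4 := Real.one_lt_goldenRatio
  have h5 : (Real.goldenRatio - 1) * weight T a ≤ weight T b := by nlinarith
  have h6 : Real.goldenRatio * ((Real.goldenRatio - 1) * weight T a)
      ≤ Real.goldenRatio * weight T b := by gcongr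
  have h7 : Real.goldenRatio * ((Real.goldenRatio - 1) * weight T a) =
      (Real.goldenRatio ^ 2 - Real.goldenRatio) * weight T a := by ring
  rw [h7, h3] at h6
  linarith

theorem IsTopPair.weight_le {C : Set T.V} {a b u : T.V} (h : IsTopPair T C a b) (hu : u ∈ C) :
    weight T u ≤ weight T a := h.2.2.1 u hu

/-- Every element of `X` other than `a` weighs at most `w_b`, and `w_b ≤ w_a` covers the case that
`a` is absent. -/
theorem IsTopPair.sum_weight_le {C : Set T.V} {a b : T.V} (h : IsTopPair T C a b)
    {X : Finset T.V} (hX : ∀ x ∈ X, x ∈ C) (hcard : X.card ≤ 2) :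
    ∑ x ∈ X, weight T x ≤ weight T a + weight T b := by
  classical
  have hba := h.weight_le h.2.1
  have hsum : ∀ Y : Finset T.V, Y ⊆ X → a ∉ Y → ∑ x ∈ Y, weight T x ≤ Y.card * weight T b := by
    intro Y hY ha
    rw [← smul_eq_mul]
    exact Finset.sum_le_card_nsmul _ _ _ fun x hx =>
      h.2.2.2.1 x (hX x (hY hx)) fun hxa => ha (hxa ▸ hx)
  by_cases ha : a ∈ X
  · rw [← Finset.add_sum_erase _ _ ha]
    have h1 := hsum (X.erase a) (Finset.erase_subset _ _) (Finset.notMem_erase _ _)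
    have h2 := Finset.card_erase_of_mem ha
    have h3 : (X.erase a).card * weight T b ≤ 1 * weight T b :=
      Nat.mul_le_mul_right _ (by omega)
    omega
  · have h1 := hsum X subset_rfl ha
    have h2 : X.card * weight T b ≤ 2 * weight T b := Nat.mul_le_mul_right _ hcard
    omega

theorem exists_root_of_level {t : ℕ} {u : T.V} (h : t < level T u) :
    ∃ x, level T x = t + 1 ∧ below T u ⊆ below T x := by
  obtain ⟨x, hx, hl⟩ := exists_ancestor_level (T := T) (v := u) (j := t + 1) h
  exact ⟨x, hl, below_subset hx⟩

/-- If all firefighters arrive in turn `t`, an optimal play protects vertices of level `t + 1`. -/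
theorem Legal.exists_saved_le_sum (hq : Legal T f q) {t : ℕ} (hf : ∀ s, s ≠ t → f s = 0) :
    ∃ X : Finset T.V, X.card ≤ f t ∧ (∀ x ∈ X, level T x = t + 1) ∧
      saved T q ≤ ∑ x ∈ X, weight T x := by
  classical
  have hg : ∀ u : T.V, ∃ x, t < level T u → level T x = t + 1 ∧ below T u ⊆ below T x := by
    intro u
    by_cases h : t < level T u
    · obtain ⟨x, hx⟩ := exists_root_of_level h
      exact ⟨x, fun _ => hx⟩
    · exact ⟨u, fun h' => absurd h' h⟩
  choose g hg using hg
  refine ⟨((q t).filter fun u => t < level T u).image g,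
    (Finset.card_image_le.trans (Finset.card_filter_le _ _)).trans (hq t).1, ?_, ?_⟩
  · intro x hx
    obtain ⟨u, hu, rfl⟩ := Finset.mem_image.1 hx
    exact (hg u (Finset.mem_filter.1 hu).2).1
  · refine (hq.saved_le (S := ⋃ x ∈ ((q t).filter fun u => t < level T u).image g,
      below T x) ?_).trans (Finset.set_ncard_biUnion_le _ _)
    intro s u hu hl
    obtain rfl : s = t := by
      by_contra hne
      rw [hq.eq_empty (hf s hne)] at hu
      simp at hu
    refine (hg u hl).2.trans (Set.subset_biUnion_of_mem (u := fun x => below T x) ?_)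
    exact Finset.mem_coe.2 (Finset.mem_image_of_mem _ (Finset.mem_filter.2 ⟨hu, hl⟩))

/-- If one firefighter arrives in turn `t` and at most one more, in turn `s`, an optimal play
protects a vertex of level `t + 1` and possibly one of level `s + 1`. -/
theorem Legal.saved_le_of_two_turns (hq : Legal T f q) {s t w : ℕ} (hs : f s ≤ 1) (ht : f t ≤ 1)
    (hf : ∀ r, r ≠ t → r ≠ s → f r = 0) (hw : ∀ u, level T u = t + 1 → weight T u ≤ w)
    (hne : ∃ u, level T u = t + 1) :
    saved T q ≤ w ∨ f s = 1 ∧ ∃ u v, level T u = t + 1 ∧ level T v = s + 1 ∧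
      ¬ AncestorOrEq T u v ∧ saved T q ≤ weight T u + weight T v := by
  have hcover : ∀ r, f r ≤ 1 → (∀ x ∈ q r, ¬ r < level T x) ∨
      ∃ u, level T u = r + 1 ∧ ∀ x ∈ q r, below T x ⊆ below T u := by
    intro r hr
    by_cases h : ∀ x ∈ q r, ¬ r < level T x
    · exact Or.inl h
    push Not at h
    obtain ⟨x, hx, hl⟩ := h
    obtain ⟨u, hu, hsub⟩ := exists_root_of_level hl
    refine Or.inr ⟨u, hu, fun y hy => ?_⟩
    rwa [Finset.card_le_one.1 ((hq r).1.trans hr) y hy x hx]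
  have hrest : ∀ r, ∀ x ∈ q r, r = t ∨ r = s := by
    intro r x hx
    by_contra! h
    rw [hq.eq_empty (hf r h.1 h.2)] at hx
    simp at hx
  -- If the play wastes the firefighter of turn `t`, any vertex of level `t + 1` serves as `u`.
  obtain ⟨u, hu, hut⟩ : ∃ u, level T u = t + 1 ∧
      ∀ x ∈ q t, t < level T x → below T x ⊆ below T u := by
    rcases hcover t ht with h | ⟨u, hu, h⟩
    · obtain ⟨u, hu⟩ := hne
      exact ⟨u, hu, fun x hx hl => absurd hl (h x hx)⟩
    · exact ⟨u, hu, fun x hx _ => h x hx⟩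
  rcases hcover s hs with h | ⟨v, hv, hsv⟩
  · refine Or.inl ((hq.saved_le (S := below T u) ?_).trans (hw u hu))
    intro r x hx hl
    rcases hrest r x hx with rfl | rfl
    · exact hut x hx hl
    · exact absurd hl (h x hx)
  by_cases huv : AncestorOrEq T u v
  · refine Or.inl ((hq.saved_le (S := below T u) ?_).trans (hw u hu))
    intro r x hx hl
    rcases hrest r x hx with rfl | rfl
    · exact hut x hx hl
    · exact (hsv x hx).trans (below_subset huv)
  by_cases hfs : f s = 1
  · refine Or.inr ⟨hfs, u, v, hu, hv, huv, ?_⟩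
    refine (hq.saved_le (S := below T u ∪ below T v) ?_).trans (Set.ncard_union_le _ _)
    intro r x hx hl
    rcases hrest r x hx with rfl | rfl
    · exact (hut x hx hl).trans Set.subset_union_left
    · exact (hsv x hx).trans Set.subset_union_right
  · refine Or.inl ((hq.saved_le (S := below T u) ?_).trans (hw u hu))
    intro r x hx hl
    rcases hrest r x hx with rfl | rfl
    · exact hut x hx hl
    · rw [hq.eq_empty (by omega)] at hx
      simp at hx

theorem sum_le_of_mem_atMost {k : ℕ} (hf : f ∈ atMost k) (S : Finset ℕ) : ∑ t ∈ S, f t ≤ k := by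
  obtain ⟨n, hn⟩ := S.exists_nat_subset_range
  exact (Finset.sum_le_sum_of_subset hn).trans (hf n)

/-- Both firefighters arrive in the same turn. -/
theorem saved_le_of_simultaneous (hp : Legal T f p) (hq : Legal T f q) {t : ℕ}
    (hserve : Serve T t (burnt T p t) ∅ (f t) (protectedBy T p (t + 1)))
    (hC : ∀ v, v ∈ children T (burnt T p t) ∅ ↔ level T v = t + 1)
    (hne : ∃ v, level T v = t + 1) (hft : f t = 2) (hf : ∀ s, s ≠ t → f s = 0) :
    saved T q ≤ saved T p := by
  obtain ⟨X, hcard, hX, hle⟩ := hq.exists_saved_le_sum hf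
  obtain ⟨v₀, hv₀⟩ := hne
  rw [hft] at hserve hcard
  rcases hserve.of_succ with ⟨h, -⟩ | ⟨c, -, hc, hserve⟩
  · exact absurd ((hC v₀).2 hv₀) (by simp [h])
  obtain ⟨a, b, hab, hcab⟩ := hc.first
  have hXC : ∀ x ∈ X, x ∈ children T (burnt T p t) ∅ := fun x hx => (hC x).2 (hX x hx)
  have hcC : c ∈ children T (burnt T p t) ∅ := by
    rcases hcab with ⟨rfl, -⟩ | ⟨rfl, -⟩
    exacts [hab.1, hab.2.1]
  rcases hserve.of_succ with ⟨h, hserve⟩ | ⟨z, -, hz, hserve⟩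
  -- No second candidate exists, so `c` is the only vertex of level `t + 1` and its subtree contains
  -- everything savable.
  · rw [children_insert, Set.sdiff_eq_empty] at h
    have hcp : c ∈ protectedBy T p (t + 1) := by rw [hserve.eq_of_zero]; simp
    refine hle.trans (le_trans ?_ (hp.weight_le_saved hcp))
    rw [← Finset.sum_singleton (weight T) c]
    exact Finset.sum_le_sum_of_subset fun x hx => Finset.mem_singleton.2 (h (hXC x hx))
  · obtain ⟨hzC, hzmax⟩ := hz.2 (Set.insert_nonempty _ _).ne_empty
    rw [children_insert] at hzC hzmax
    have hcp : c ∈ protectedBy T p (t + 1) := by rw [hserve.eq_of_zero]; simp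
    have hzp : z ∈ protectedBy T p (t + 1) := by rw [hserve.eq_of_zero]; simp
    have hlc := (hC c).1 hcC
    have hlz := (hC z).1 hzC.1
    have hcz : ¬ AncestorOrEq T c z := fun h => hzC.2 (h.eq_of_level (by omega)).symm
    have hzc : ¬ AncestorOrEq T z c := fun h => hzC.2 (h.eq_of_level (by omega))
    have h1 := hp.weight_add_weight_le_saved hcp hzp hcz hzc
    have hne : a ≠ b := by
      intro h
      have hCa := hab.2.2.2.2 h
      rw [hCa] at hcC hzC
      exact hzC.2 (hzC.1.trans hcC.symm)
    have h2 := hab.sum_weight_le hXC hcard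
    rcases hcab with ⟨rfl, -⟩ | ⟨rfl, -⟩
    · have := hzmax b ⟨hab.2.1, hne.symm⟩
      omega
    · have := hzmax a ⟨hab.1, hne⟩
      omega

/-- The second firefighter of the algorithm, placed in turn `s`. -/
theorem exists_second_placement (hp : Legal T f p) {s t : ℕ} {c : T.V} (hts : t < s)
    (hc : level T c = t + 1) (hQ : protectedBy T p s = {c})
    (hserve : Serve T s (burnt T p s) {c} 1 (protectedBy T p (s + 1))) :
    ∃ M, weight T c + M ≤ saved T p ∧
      ∀ v, level T v = s + 1 → ¬ AncestorOrEq T c v → weight T v ≤ M := by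
  have hC : ∀ v, v ∈ children T (burnt T p s) {c} ↔ level T v = s + 1 ∧ ¬ AncestorOrEq T c v := by
    intro v
    rw [← hQ, hp.mem_children_iff, hQ]
    refine and_congr_right fun _ => ⟨fun h h' => h c h' rfl, ?_⟩
    rintro h u hu rfl
    exact h hu
  rcases hserve.of_succ with ⟨h, hserve⟩ | ⟨z, -, hz, hserve⟩
  -- The second firefighter has no place to go; `M = 0` works because no vertex of level `s + 1`
  -- lies outside the subtree of `c`.
  · refine ⟨0, hp.weight_le_saved (n := s) (by rw [hQ]; rfl), fun v hv hcv => ?_⟩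
    exact absurd ((hC v).2 ⟨hv, hcv⟩) (by simp [h])
  · obtain ⟨hzC, hzmax⟩ := hz.2 (Set.singleton_ne_empty c)
    obtain ⟨hzl, hcz⟩ := (hC z).1 hzC
    refine ⟨weight T z, hp.weight_add_weight_le_saved (n := s + 1) ?_ ?_ hcz ?_,
      fun v hv hcv => hzmax v ((hC v).2 ⟨hv, hcv⟩)⟩
    · rw [hserve.eq_of_zero]; simp
    · rw [hserve.eq_of_zero]; simp
    · intro h
      have := h.level_le
      omega

/-- The firefighters arrive one at a time. -/
theorem saved_le_of_successive (hp : Legal T f p) (hq : Legal T f q) {s t : ℕ} (hts : t < s)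
    (hserve : Serve T t (burnt T p t) ∅ (f t) (protectedBy T p (t + 1)))
    (hserve' : Serve T s (burnt T p s) (protectedBy T p s) (f s) (protectedBy T p (s + 1)))
    (hC : ∀ v, v ∈ children T (burnt T p t) ∅ ↔ level T v = t + 1)
    (hne : ∃ v, level T v = t + 1) (hft : f t = 1) (hfs : f s ≤ 1)
    (hf : ∀ r, r ≠ t → r ≠ s → f r = 0) :
    (saved T q : ℝ) ≤ Real.goldenRatio * saved T p := by
  obtain ⟨v₀, hv₀⟩ := hne
  rw [hft] at hserve
  rcases hserve.of_succ with ⟨h, -⟩ | ⟨c, -, hc, hserve⟩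
  · exact absurd ((hC v₀).2 hv₀) (by simp [h])
  obtain ⟨a, b, hab, hcab⟩ := hc.first
  have hQ : protectedBy T p (t + 1) = {c} := by rw [hserve.eq_of_zero]; simp
  have hQs : protectedBy T p s = {c} := by
    refine (hQ ▸ protectedBy_mono hts).antisymm' ?_
    rintro v ⟨r, hr, hv⟩
    by_contra hvc
    rcases lt_or_ge t r with h | h
    · rw [hp.eq_empty (hf r h.ne' hr.ne)] at hv
      simp at hv
    · exact hvc (hQ ▸ ⟨r, by omega, hv⟩)
  have ha := (hC a).1 hab.1
  have hb := (hC b).1 hab.2.1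
  have hwa : ∀ u, level T u = t + 1 → weight T u ≤ weight T a :=
    fun u hu => hab.weight_le ((hC u).2 hu)
  have hφ := Real.one_lt_goldenRatio
  have hφ2 := Real.goldenRatio_sq
  have hac : (weight T a : ℝ) ≤ Real.goldenRatio * weight T c := by
    rcases hcab with ⟨rfl, -⟩ | ⟨rfl, -, h⟩
    · exact le_mul_of_one_le_left (by positivity) hφ.le
    · exact weight_le_of_not_firstTest h
  have hcp : (weight T c : ℝ) ≤ saved T p :=
    mod_cast hp.weight_le_saved (n := s) (by rw [hQs]; rfl)
  rcases hq.saved_le_of_two_turns hfs hft.le hf hwa ⟨a, ha⟩ with h | ⟨hfs1, u, v, hu, hv, huv, h⟩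
  · have h1 : (saved T q : ℝ) ≤ weight T a := mod_cast h
    exact h1.trans (hac.trans (by gcongr))
  rw [hfs1, hQs] at hserve'
  have hcl : level T c = t + 1 := by
    rcases hcab with ⟨rfl, -⟩ | ⟨rfl, -⟩ <;> assumption
  obtain ⟨M, hM, hMmax⟩ := exists_second_placement hp hts hcl hQs hserve'
  have hM' : (weight T c : ℝ) + M ≤ saved T p := mod_cast hM
  have h' : (saved T q : ℝ) ≤ weight T u + weight T v := mod_cast h
  have hua : (weight T u : ℝ) ≤ weight T a := mod_cast hwa u hu
  refine h'.trans (le_trans ?_ (mul_le_mul_of_nonneg_left hM' (by positivity)))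
  have hM0 : (0 : ℝ) ≤ M := by positivity
  -- If `v` is not below `c`, then `w_v ≤ M`, and `w_u ≤ w_a ≤ φ w_c` finishes.
  by_cases hcv : AncestorOrEq T c v
  swap
  · have h1 : (weight T v : ℝ) ≤ M := mod_cast hMmax v hv hcv
    nlinarith
  have hother : ∀ d, level T d = t + 1 → d ≠ c → (maxWeightBelow T d (s + 1) : ℝ) ≤ M := by
    intro d hd hdc
    exact_mod_cast maxWeightBelow_le fun w hw hwl =>
      hMmax w hwl fun hcw => hdc (hw.unique hcw (by omega))
  have hvc : (weight T v : ℝ) ≤ maxWeightBelow T c (s + 1) := mod_cast le_maxWeightBelow hcv hv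
  -- For `c = a`: as `v` lies below `a` and not below `u`, the vertex `u` differs from `a` and
  -- weighs at most `w_b`. The test at level `s + 1` is then the required inequality.
  rcases hcab with ⟨rfl, htest⟩ | ⟨rfl, hne, htest⟩
  · have huc : u ≠ c := fun h => huv (h ▸ hcv)
    have hbc : b ≠ c := by
      intro h
      have h1 := (hC u).2 hu
      rw [hab.2.2.2.2 h.symm] at h1
      exact huc h1
    have hub : (weight T u : ℝ) ≤ weight T b := mod_cast hab.2.2.2.1 u ((hC u).2 hu) huc
    have h1 := htest (s + 1) (by omega) (by have := level_le_height v; omega)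
    have hb0 : (0 : ℝ) < weight T b := mod_cast weight_pos b
    rw [div_le_div_iff₀ Real.goldenRatio_pos (by positivity)] at h1
    have h2 := hother b hb hbc
    have h3 : ((weight T c : ℝ) + maxWeightBelow T b (s + 1)) * Real.goldenRatio ≤
        (weight T c + M) * Real.goldenRatio := by gcongr
    linarith
  · have h2 := hother a ha hne
    obtain ⟨i, hi, hlt⟩ := exists_of_not_firstTest htest
    have hai : (maxWeightBelow T a i : ℝ) ≤ weight T a := mod_cast maxWeightBelow_le_weight a i
    have hbi : (0 : ℝ) ≤ maxWeightBelow T c i := by positivity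
    -- Here `c = b`, and the test failed at level `i`. For `i ≤ s + 1`, weights below `b` have not
    -- grown since level `i`, so `φ (w_u + w_v) ≤ w_b + w_a ≤ (1 + φ) w_b = φ² w_b`.
    rcases le_total i (s + 1) with hij | hij
    · have h3 : (maxWeightBelow T c (s + 1) : ℝ) ≤ maxWeightBelow T c i :=
        mod_cast maxWeightBelow_anti c (by omega) hij
      have h4 : Real.goldenRatio * (weight T u + weight T v) ≤
          Real.goldenRatio * (Real.goldenRatio * weight T c) := by
        have h5 : Real.goldenRatio * (weight T u + weight T v) ≤
            Real.goldenRatio * (weight T a + maxWeightBelow T c i) :=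
          mul_le_mul_of_nonneg_left (by linarith) Real.goldenRatio_pos.le
        nlinarith
      have h6 := le_of_mul_le_mul_left h4 Real.goldenRatio_pos
      nlinarith
    -- For `i ≥ s + 1`, the heavy vertex below `a` is still available: `φ w_a ≤ w_b + M ≤ w_a + M`,
    -- hence `w_a ≤ φ M`, while `w_v ≤ w_b`.
    · have h3 : (maxWeightBelow T a i : ℝ) ≤ maxWeightBelow T a (s + 1) :=
        mod_cast maxWeightBelow_anti a (by omega) hij
      have hcs : (maxWeightBelow T c (s + 1) : ℝ) ≤ weight T c :=
        mod_cast maxWeightBelow_le_weight c (s + 1)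
      have hca : (weight T c : ℝ) ≤ weight T a := mod_cast hwa c hcl
      have h4 : (Real.goldenRatio - 1) * weight T a ≤ M := by
        nlinarith
      have h5 : Real.goldenRatio * ((Real.goldenRatio - 1) * weight T a) ≤
          Real.goldenRatio * M := mul_le_mul_of_nonneg_left h4 Real.goldenRatio_pos.le
      have h6 : Real.goldenRatio * ((Real.goldenRatio - 1) * weight T a) = weight T a := by
        linear_combination (weight T a : ℝ) * hφ2
      nlinarith

theorem IsTwoFirefighterOn.saved_le {A : Strategy T} (hA : IsTwoFirefighterOn T A)
    (hf : f ∈ atMost 2) (hq : Legal T f q) :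
    (saved T q : ℝ) ≤ Real.goldenRatio * saved T (A.play f) := by
  classical
  have hp := A.legal f
  have hserve := hA f
  generalize A.play f = p at hp hserve
  have hzero : saved T q = 0 → (saved T q : ℝ) ≤ Real.goldenRatio * saved T p := by
    intro h
    rw [h, Nat.cast_zero]
    positivity
  by_cases hex : ∃ t, f t ≠ 0
  swap
  · push Not at hex
    refine hzero (Nat.le_zero.1 ((hq.saved_le (S := ∅) fun t u hu => ?_).trans_eq (by simp)))
    rw [hq.eq_empty (hex t)] at hu
    simp at hu
  obtain ⟨t, ht, hbefore⟩ : ∃ t, f t ≠ 0 ∧ ∀ s < t, f s = 0 :=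
    ⟨Nat.find hex, Nat.find_spec hex, fun s hs => not_not.1 (Nat.find_min hex hs)⟩
  by_cases hne : ∃ v, level T v = t + 1
  swap
  · refine hzero (Nat.le_zero.1 ((hq.saved_le (S := ∅) fun s u hu hl => ?_).trans_eq (by simp)))
    rcases lt_or_ge s t with h | h
    · rw [hq.eq_empty (hbefore s h)] at hu
      simp at hu
    · obtain ⟨x, hx, -⟩ := exists_root_of_level (h.trans_lt hl)
      exact absurd ⟨x, hx⟩ hne
  have hQ : protectedBy T p t = ∅ := by
    refine Set.eq_empty_of_forall_notMem ?_
    rintro v ⟨s, hs, hv⟩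
    rw [hp.eq_empty (hbefore s hs)] at hv
    simp at hv
  have hC : ∀ v, v ∈ children T (burnt T p t) ∅ ↔ level T v = t + 1 := by
    intro v
    rw [← hQ, hp.mem_children_iff, hQ]
    simp
  have hst := hserve t
  rw [hQ] at hst
  have hpair : ∀ s, s ≠ t → f t + f s ≤ 2 := by
    intro s hs
    have := sum_le_of_mem_atMost hf {t, s}
    rwa [Finset.sum_pair hs.symm] at this
  have ht2 : f t ≤ 2 := by simpa using sum_le_of_mem_atMost hf {t}
  obtain h1 | h2 : f t = 1 ∨ f t = 2 := by omega
  · obtain ⟨s, hts, hfs⟩ : ∃ s, t < s ∧ ∀ r, r ≠ t → r ≠ s → f r = 0 := by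
      by_cases h : ∃ s, s ≠ t ∧ f s ≠ 0
      · obtain ⟨s, hs, hs0⟩ := h
        refine ⟨s, ?_, fun r hrt hrs => ?_⟩
        · by_contra hlt
          exact hs0 (hbefore s (by omega))
        · have := sum_le_of_mem_atMost hf {t, s, r}
          rw [Finset.sum_insert (by simp [hs.symm, hrt.symm]), Finset.sum_pair hrs.symm] at this
          omega
      · push Not at h
        -- With a single firefighter, `t + 1` stands in for the second turn, where nothing arrives.
        exact ⟨t + 1, by omega, fun r hr _ => h r hr⟩
    have := hpair s (by omega)
    exact saved_le_of_successive hp hq hts hst (hserve s) hC hne h1 (by omega) hfs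
  · have h3 : saved T q ≤ saved T p := saved_le_of_simultaneous hp hq hst hC hne h2 fun s hs => by
      have := hpair s hs
      omega
    have h4 : (saved T q : ℝ) ≤ saved T p := mod_cast h3
    exact h4.trans (le_mul_of_one_le_left (by positivity) Real.one_lt_goldenRatio.le)

theorem IsTwoFirefighterAlgorithm.competitive {A : OnlineAlgorithm}
    (hA : IsTwoFirefighterAlgorithm A) : Competitive A (atMost 2) (1 / Real.goldenRatio) := by
  have h1 : 1 / Real.goldenRatio ≤ 1 := by
    rw [div_le_one Real.goldenRatio_pos]
    exact Real.one_lt_goldenRatio.le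
  refine ⟨by positivity, h1, fun T f hf => le_ratio h1 fun q hq => ?_⟩
  rw [one_div, inv_mul_le_iff₀ Real.goldenRatio_pos]
  exact (hA T).saved_le hf hq

end TwoFirefightersAnalysis

/-! ### Adversarial sequences on the first three turns -/

section Adversary

/-- One firefighter in the first turn, `a` in the second and `b` in the third. -/
def arrivals (a b : ℕ) : ℕ → ℕ
  | 0 => 1
  | 1 => a
  | 2 => b
  | _ + 3 => 0

theorem arrivals_mem_atMost {a b k : ℕ} (h : 1 + a + b ≤ k) : arrivals a b ∈ atMost k := by
  intro n
  refine le_trans ?_ h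
  refine (Finset.sum_le_sum_of_subset (Finset.range_mono (Nat.le_add_right n 3))).trans ?_
  rw [Finset.sum_range_succ', Finset.sum_range_succ', Finset.sum_range_succ']
  simp only [arrivals, Finset.sum_const_zero]
  omega

variable {T : RootedTree}

/-- The play that protects `P`, `Q` and `R` in the first three turns. -/
def plan {α : Type*} (P Q R : Finset α) : ℕ → Finset α
  | 0 => P
  | 1 => Q
  | 2 => R
  | _ + 3 => ∅

theorem legal_plan {P Q R : Finset T.V} {a b : ℕ} (hP : P.card ≤ 1) (hQ : Q.card ≤ a)
    (hR : R.card ≤ b) (hPl : ∀ v ∈ P, level T v = 1) (hQl : ∀ v ∈ Q, level T v = 2)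
    (hRl : ∀ v ∈ R, level T v = 3) : Legal T (arrivals a b) (plan P Q R) := by
  have hlev : ∀ t, ∀ v ∈ plan P Q R t, level T v = t + 1 := by
    intro t v hv
    match t with
    | 0 => exact hPl v hv
    | 1 => exact hQl v hv
    | 2 => exact hRl v hv
    | _ + 3 => simp [plan] at hv
  refine legal_of_level (fun t => ?_) fun t v hv => ⟨by rw [hlev t v hv]; omega, ?_⟩
  · match t with
    | 0 => exact hP
    | 1 => exact hQ
    | 2 => exact hR
    | _ + 3 => simp [plan]
  · rintro ⟨s, hs, hvs⟩
    have h1 := hlev t v hv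
    have h2 := hlev s v hvs
    omega

end Adversary

/-! ### Play on the trees `W k l m` -/

section TreeW

open WVertex

variable {k l m : ℕ}

theorem WVertex.depth_eq_depth_parent_add_one (v : WVertex k l m) (hv : v ≠ .r) :
    v.depth = v.parent.depth + 1 := by
  match v with
  | r => exact absurd rfl hv
  | x => rfl
  | center => rfl
  | leaf _ => rfl
  | y => rfl
  | chain _ ⟨0, _⟩ => rfl
  | chain i ⟨j + 1, h⟩ => rfl

theorem W_adj_parent (v : WVertex k l m) (hv : v ≠ .r) : (W k l m).graph.Adj v.parent v := by
  refine SimpleGraph.Adj.symm ?_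
  change (WGraph k l m).Adj v v.parent
  rw [WGraph, SimpleGraph.fromRel_adj]
  refine ⟨fun h => ?_, Or.inl rfl⟩
  have := WVertex.depth_parent v hv
  rw [← h] at this
  exact lt_irrefl _ this

theorem W_depth_le_of_adj {u v : WVertex k l m} (h : (W k l m).graph.Adj u v) :
    v.depth ≤ u.depth + 1 := by
  change (WGraph k l m).Adj u v at h
  rw [WGraph, SimpleGraph.fromRel_adj] at h
  obtain ⟨hne, rfl | rfl⟩ := h
  · have hu : u ≠ .r := by rintro rfl; exact hne rfl
    have := u.depth_parent hu
    omega
  · have hv : v ≠ .r := by rintro rfl; exact hne rfl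
    exact (v.depth_eq_depth_parent_add_one hv).le

/-- Following parents reaches the root in `v.depth` steps, and no edge raises the depth by more than
one. -/
theorem W_level (v : WVertex k l m) : level (W k l m) v = v.depth := by
  refine le_antisymm ?_ ?_
  · induction hn : v.depth generalizing v with
    | zero =>
      by_cases hv : v = .r
      · rw [hv]
        exact (level_root (T := W k l m)).le
      · have := v.depth_parent hv
        omega
    | succ n ih =>
      have hv : v ≠ .r := by
        rintro rfl
        simp [depth] at hn
      have h1 := v.depth_eq_depth_parent_add_one hv
      have h2 := ih v.parent (by omega)
      have h3 := level_eq_of_adj (W_adj_parent v hv)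
      omega
  · induction hn : level (W k l m) v generalizing v with
    | zero =>
      rw [eq_root_of_level_eq_zero hn]
      exact le_rfl
    | succ n ih =>
      obtain ⟨w, hw, hwl⟩ := exists_parent hn
      have h1 := ih w hwl
      have h2 := W_depth_le_of_adj hw
      omega

theorem W_level_parent (v : WVertex k l m) (hv : v ≠ .r) :
    level (W k l m) v = level (W k l m) v.parent + 1 := by
  rw [W_level, W_level]
  exact v.depth_eq_depth_parent_add_one hv

theorem W_ancestor_parent (v : WVertex k l m) (hv : v ≠ .r) :
    AncestorOrEq (W k l m) v.parent v :=
  .of_adj (W_adj_parent v hv) (W_level_parent v hv)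

/-- A set that contains `u` and is closed under taking children contains the subtree of `u`. -/
theorem W_mem_of_ancestor {S : Finset (WVertex k l m)} {u : WVertex k l m} (hu : u ∈ S)
    (hS : ∀ v, v ≠ .r → v.parent ∈ S → v ∈ S) (v : WVertex k l m)
    (huv : AncestorOrEq (W k l m) u v) : v ∈ S := by
  induction hn : v.depth using Nat.strong_induction_on generalizing v with
  | _ n ih =>
    by_cases huv' : u = v
    · exact huv' ▸ hu
    have hv : v ≠ .r := by
      rintro rfl
      refine huv' (huv.eq_of_level ?_)
      rw [W_level]
      exact Nat.zero_le _
    exact hS v hv (ih _ (hn ▸ v.depth_parent hv) v.parent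
      (huv.of_parent huv' (W_adj_parent v hv) (W_level_parent v hv)) rfl)

section Interface

variable {f : ℕ → ℕ} {p : ℕ → Finset (WVertex k l m)}

theorem W_saved_le_card (hp : Legal (W k l m) f p) {S : Finset (WVertex k l m)}
    (hS : ∀ t, ∀ u ∈ p t, t < u.depth → ∀ v : WVertex k l m, AncestorOrEq (W k l m) u v → v ∈ S) :
    saved (W k l m) p ≤ S.card := by
  rw [← Set.ncard_coe_finset]
  exact hp.saved_le fun t u hu hl v huv => hS t u hu (hl.trans_eq (W_level u)) v huv

theorem W_card_le_saved (hp : Legal (W k l m) f p) {S : Finset (WVertex k l m)}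
    (hS : ∀ v ∈ S, ∃ t, ∃ u ∈ p t, AncestorOrEq (W k l m) u v) :
    S.card ≤ saved (W k l m) p := by
  rw [← Set.ncard_coe_finset]
  exact hp.ncard_le_saved fun v hv => hS v hv

theorem W_notMem (hp : Legal (W k l m) f p) {t : ℕ} (ht : f t = 0) (u : WVertex k l m) :
    u ∉ p t := by
  have h : p t = ∅ := hp.eq_empty ht
  simp [h]

theorem W_legal_plan {P Q R : Finset (WVertex k l m)} {a b : ℕ} (hP : P.card ≤ 1)
    (hQ : Q.card ≤ a) (hR : R.card ≤ b) (hPl : ∀ v ∈ P, v.depth = 1) (hQl : ∀ v ∈ Q, v.depth = 2)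
    (hRl : ∀ v ∈ R, v.depth = 3) : Legal (W k l m) (arrivals a b) (plan P Q R) :=
  legal_plan (T := W k l m) hP hQ hR (fun v hv => (W_level v).trans (hPl v hv))
    (fun v hv => (W_level v).trans (hQl v hv)) fun v hv => (W_level v).trans (hRl v hv)

end Interface

theorem W_ancestor_chain (i : Fin k) {a b : Fin ((m - 1) / k)} (h : a ≤ b) :
    AncestorOrEq (W k l m) (chain i a) (chain i b) := by
  obtain ⟨b, hb⟩ := b
  induction b with
  | zero =>
    obtain rfl : a = ⟨0, hb⟩ := le_antisymm h (Nat.zero_le _)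
    exact .refl _
  | succ b ih =>
    by_cases hab : a = ⟨b + 1, hb⟩
    · rw [hab]
      exact .refl _
    · have h1 : (a : ℕ) ≠ b + 1 := fun h => hab (Fin.ext h)
      have h2 : (a : ℕ) ≤ b + 1 := h
      refine (ih (by omega) (show (a : ℕ) ≤ b by omega)).trans ?_
      exact W_ancestor_parent (chain i ⟨b + 1, hb⟩) (by simp)

theorem W_ancestor_y_chain (i : Fin k) (j : Fin ((m - 1) / k)) :
    AncestorOrEq (W k l m) y (chain i j) :=
  have h0 : 0 < (m - 1) / k := (Nat.zero_le _).trans_lt j.2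
  (W_ancestor_parent (chain i ⟨0, h0⟩) (by simp)).trans (W_ancestor_chain i (Nat.zero_le _))

theorem W_ancestor_center_leaf (i : Fin (l - 2)) : AncestorOrEq (W k l m) center (leaf i) :=
  W_ancestor_parent (leaf i) (by simp)

theorem W_ancestor_x_center : AncestorOrEq (W k l m) x center :=
  W_ancestor_parent center (by simp)

/-- The center and the leaves below it. -/
def starBranch (k l m : ℕ) : Finset (WVertex k l m) := insert center (Finset.univ.image leaf)

/-- The branch of `x`. -/
def xBranch (k l m : ℕ) : Finset (WVertex k l m) := insert x (starBranch k l m)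

/-- The part of the chains with index in `J` that starts at position `n`. -/
def chainsFrom (k l m : ℕ) (J : Finset (Fin k)) (n : ℕ) : Finset (WVertex k l m) :=
  (J ×ˢ Finset.univ.filter fun j : Fin ((m - 1) / k) => n ≤ (j : ℕ)).image
    fun ij => chain ij.1 ij.2

/-- The branch of `y`. -/
def yBranch (k l m : ℕ) : Finset (WVertex k l m) := insert y (chainsFrom k l m Finset.univ 0)

theorem card_starBranch (hl : 2 ≤ l) : (starBranch k l m).card = l - 1 := by
  rw [starBranch, Finset.card_insert_of_notMem (by simp),
    Finset.card_image_of_injective _ (fun i j h => by simpa using h)]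
  simp only [Finset.card_univ, Fintype.card_fin]
  omega

theorem card_xBranch (hl : 2 ≤ l) : (xBranch k l m).card = l := by
  rw [xBranch, Finset.card_insert_of_notMem (by simp [starBranch]), card_starBranch hl]
  omega

theorem card_chainsFrom (J : Finset (Fin k)) (n : ℕ) :
    (chainsFrom k l m J n).card = J.card * ((m - 1) / k - n) := by
  rw [chainsFrom, Finset.card_image_of_injective _ (fun i j h => by
    simpa [Prod.ext_iff] using h), Finset.card_product]
  congr 1
  generalize (m - 1) / k = N
  rw [← Finset.card_map Fin.valEmbedding, ← Nat.card_Ico]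
  congr 1
  ext j
  simp only [Finset.mem_map, Finset.mem_filter, Finset.mem_univ, true_and, Fin.valEmbedding_apply,
    Finset.mem_Ico]
  constructor
  · rintro ⟨i, hi, rfl⟩
    exact ⟨hi, i.2⟩
  · rintro ⟨h1, h2⟩
    exact ⟨⟨j, h2⟩, h1, rfl⟩

theorem card_yBranch (hm : 1 ≤ m) (hkm : k ∣ m - 1) : (yBranch k l m).card = m := by
  rw [yBranch, Finset.card_insert_of_notMem (by simp [chainsFrom]), card_chainsFrom]
  simp only [Finset.card_univ, Fintype.card_fin, Nat.sub_zero]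
  rw [Nat.mul_div_cancel' hkm]
  omega

theorem W_mem_xBranch {u : WVertex k l m} (hu : u ∈ xBranch k l m) :
    ∀ v : WVertex k l m, AncestorOrEq (W k l m) u v → v ∈ xBranch k l m := by
  refine W_mem_of_ancestor hu fun v hv h => ?_
  match v with
  | r => exact absurd rfl hv
  | x => simp [xBranch]
  | center => simp [xBranch, starBranch]
  | leaf _ => simp [xBranch, starBranch]
  | y => simp [xBranch, starBranch, parent] at h
  | chain _ ⟨0, _⟩ => simp [xBranch, starBranch, parent] at h
  | chain i ⟨j + 1, h'⟩ => simp [xBranch, starBranch, parent] at h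

theorem mem_yBranch_y : (y : WVertex k l m) ∈ yBranch k l m := by simp [yBranch]

theorem mem_yBranch_chain (i : Fin k) (j : Fin ((m - 1) / k)) :
    (chain i j : WVertex k l m) ∈ yBranch k l m := by simp [yBranch, chainsFrom]

theorem W_mem_yBranch {u : WVertex k l m} (hu : u ∈ yBranch k l m) :
    ∀ v : WVertex k l m, AncestorOrEq (W k l m) u v → v ∈ yBranch k l m := by
  refine W_mem_of_ancestor hu fun v hv h => ?_
  match v with
  | r => exact absurd rfl hv
  | x => simp [yBranch, chainsFrom, parent] at h
  | center => simp [yBranch, chainsFrom, parent] at h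
  | leaf _ => simp [yBranch, chainsFrom, parent] at h
  | y => exact mem_yBranch_y
  | chain i j => exact mem_yBranch_chain i j

theorem W_mem_chain (i : Fin k) (j : Fin ((m - 1) / k)) :
    ∀ v : WVertex k l m, AncestorOrEq (W k l m) (chain i j) v → v ∈ chainsFrom k l m {i} 0 := by
  refine W_mem_of_ancestor (by simp [chainsFrom]) fun v hv h => ?_
  match v with
  | r => exact absurd rfl hv
  | x => simp [chainsFrom, parent] at h
  | center => simp [chainsFrom, parent] at h
  | leaf _ => simp [chainsFrom, parent] at h
  | y => simp [chainsFrom, parent] at h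
  | chain _ ⟨0, _⟩ => simp [chainsFrom, parent] at h
  | chain i ⟨j + 1, h'⟩ => simpa [chainsFrom, parent] using h

theorem W_eq_leaf (i : Fin (l - 2)) :
    ∀ v : WVertex k l m, AncestorOrEq (W k l m) (leaf i) v →
      v ∈ ({leaf i} : Finset (WVertex k l m)) := by
  refine W_mem_of_ancestor (Finset.mem_singleton_self _) fun v hv h => ?_
  match v with
  | r => exact absurd rfl hv
  | x => simp [parent] at h
  | center => simp [parent] at h
  | leaf _ => simp [parent] at h
  | y => simp [parent] at h
  | chain _ ⟨0, _⟩ => simp [parent] at h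
  | chain i ⟨j + 1, h'⟩ => simp [parent] at h

variable {p : ℕ → Finset (WVertex k l m)}

/-- The first firefighter is spent below `x`, and no other comes. -/
theorem W_saved_le_of_x (hl : 2 ≤ l) (hp : Legal (W k l m) (arrivals 0 0) p)
    (h0 : p 0 ⊆ xBranch k l m) : saved (W k l m) p ≤ l := by
  refine (W_saved_le_card hp (S := xBranch k l m) fun t u hu _ => ?_).trans (card_xBranch hl).le
  match t with
  | 0 => exact W_mem_xBranch (h0 hu)
  | 1 => exact (W_notMem hp rfl u hu).elim
  | 2 => exact (W_notMem hp rfl u hu).elim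
  | t + 3 => exact (W_notMem hp rfl u hu).elim

/-- The first firefighter is spent below `x`, and another one comes in the second turn. -/
theorem W_saved_le_of_x_of_second (hl : 2 ≤ l) (hp : Legal (W k l m) (arrivals 1 0) p)
    (h0 : p 0 ⊆ xBranch k l m) : saved (W k l m) p ≤ l + (m - 1) / k := by
  -- The single firefighter of the second turn can no longer take `y`, so it gains at most one whole
  -- chain.
  obtain ⟨C, hC, hsub⟩ : ∃ C : Finset (WVertex k l m), C.card ≤ (m - 1) / k ∧
      ∀ i j, chain i j ∈ p 1 → chainsFrom k l m {i} 0 ⊆ C := by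
    by_cases h : ∃ i j, chain i j ∈ p 1
    · obtain ⟨i, j, hij⟩ := h
      refine ⟨chainsFrom k l m {i} 0, by rw [card_chainsFrom]; simp, fun i' j' hij' => ?_⟩
      have h1 : (chain i' j' : WVertex k l m) = chain i j :=
        Finset.card_le_one.1 (hp 1).1 _ hij' _ hij
      rw [WVertex.chain.injEq] at h1
      rw [h1.1]
    · exact ⟨∅, by simp, fun i j hij => absurd ⟨i, j, hij⟩ h⟩
  have hle : saved (W k l m) p ≤ (xBranch k l m ∪ C).card := by
    refine W_saved_le_card hp fun t u hu hlt v huv => ?_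
    match t with
    | 0 => exact Finset.mem_union_left _ (W_mem_xBranch (h0 hu) v huv)
    | 1 =>
      match u with
      | r => simp [depth] at hlt
      | x => simp [depth] at hlt
      | y => simp [depth] at hlt
      | center =>
        exact Finset.mem_union_left _ (W_mem_xBranch (by simp [xBranch, starBranch]) v huv)
      | leaf _ =>
        exact Finset.mem_union_left _ (W_mem_xBranch (by simp [xBranch, starBranch]) v huv)
      | chain i j => exact Finset.mem_union_right _ (hsub i j hu (W_mem_chain i j v huv))
    | 2 => exact (W_notMem hp rfl u hu).elim
    | t + 3 => exact (W_notMem hp rfl u hu).elim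
  have h1 := Finset.card_union_le (xBranch k l m) C
  rw [card_xBranch hl] at h1
  omega

/-- The first firefighter is spent below `y`, and `b` more come in the third turn. -/
theorem W_saved_le_of_y {b : ℕ} (hm : 1 ≤ m) (hkm : k ∣ m - 1)
    (hp : Legal (W k l m) (arrivals 0 b) p) (h0 : p 0 ⊆ yBranch k l m) :
    saved (W k l m) p ≤ m + b := by
  -- In the third turn only leaves of the star lie ahead of the fire, so each new firefighter adds
  -- at most one vertex outside the branch of `y`.
  have hle : saved (W k l m) p ≤ (yBranch k l m ∪ p 2).card := by
    refine W_saved_le_card hp fun t u hu hlt v huv => ?_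
    match t with
    | 0 => exact Finset.mem_union_left _ (W_mem_yBranch (h0 hu) v huv)
    | 1 => exact (W_notMem hp rfl u hu).elim
    | 2 =>
      match u with
      | r => simp [depth] at hlt
      | x => simp [depth] at hlt
      | y => simp [depth] at hlt
      | center => simp [depth] at hlt
      | leaf i =>
        rw [Finset.mem_singleton.1 (W_eq_leaf i v huv)]
        exact Finset.mem_union_right _ hu
      | chain i j =>
        exact Finset.mem_union_left _ (W_mem_yBranch (mem_yBranch_chain i j) v huv)
    | t + 3 => exact (W_notMem hp rfl u hu).elim
  have h1 := Finset.card_union_le (yBranch k l m) (p 2)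
  have h2 : (p 2).card ≤ b := (hp 2).1
  rw [card_yBranch hm hkm] at h1
  omega

theorem W_exists_plan_y (hm : 1 ≤ m) (hkm : k ∣ m - 1) :
    ∃ q, Legal (W k l m) (arrivals 0 0) q ∧ m ≤ saved (W k l m) q := by
  have hq := W_legal_plan (P := {(y : WVertex k l m)}) (Q := ∅) (R := ∅) (a := 0) (b := 0)
    (by simp) (by simp) (by simp) (by simp [depth]) (by simp) (by simp)
  refine ⟨_, hq, (card_yBranch (k := k) (l := l) hm hkm).ge.trans ?_⟩
  refine W_card_le_saved hq fun v hv => ⟨0, y, Finset.mem_singleton_self _, ?_⟩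
  simp only [yBranch, chainsFrom, Finset.mem_insert, Finset.mem_image] at hv
  rcases hv with rfl | ⟨ij, -, rfl⟩
  · exact .refl _
  · exact W_ancestor_y_chain _ _

theorem W_exists_plan_y_center (hl : 2 ≤ l) (hm : 1 ≤ m) (hkm : k ∣ m - 1) :
    ∃ q, Legal (W k l m) (arrivals 1 0) q ∧ m + (l - 1) ≤ saved (W k l m) q := by
  have hq := W_legal_plan (P := {(y : WVertex k l m)}) (Q := {center}) (R := ∅) (a := 1) (b := 0)
    (by simp) (by simp) (by simp) (by simp [depth]) (by simp [depth]) (by simp)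
  have hd : Disjoint (yBranch k l m) (starBranch k l m) := by
    simp only [yBranch, starBranch, chainsFrom, Finset.disjoint_left, Finset.mem_insert,
      Finset.mem_image]
    rintro v (rfl | ⟨ij, -, rfl⟩) <;> simp
  have hcard : (yBranch k l m ∪ starBranch k l m).card = m + (l - 1) := by
    rw [Finset.card_union_of_disjoint hd, card_yBranch hm hkm, card_starBranch hl]
  refine ⟨_, hq, hcard.ge.trans (W_card_le_saved hq fun v hv => ?_)⟩
  simp only [yBranch, starBranch, chainsFrom, Finset.mem_union, Finset.mem_insert,
    Finset.mem_image] at hv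
  rcases hv with (rfl | ⟨ij, -, rfl⟩) | (rfl | ⟨i, -, rfl⟩)
  · exact ⟨0, y, Finset.mem_singleton_self _, .refl _⟩
  · exact ⟨0, y, Finset.mem_singleton_self _, W_ancestor_y_chain _ _⟩
  · exact ⟨1, center, Finset.mem_singleton_self _, .refl _⟩
  · exact ⟨1, center, Finset.mem_singleton_self _, W_ancestor_center_leaf _⟩

theorem W_exists_plan_x_chains {b : ℕ} (hl : 2 ≤ l) (hb : b ≤ k) (hn : 2 ≤ (m - 1) / k) :
    ∃ q, Legal (W k l m) (arrivals 0 b) q ∧ l + b * ((m - 1) / k - 1) ≤ saved (W k l m) q := by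
  obtain ⟨J, hJ⟩ : ∃ J : Finset (Fin k), J.card = b := by
    obtain ⟨J, -, hJ⟩ := Finset.exists_subset_card_eq (s := (Finset.univ : Finset (Fin k)))
      (n := b) (by simpa using hb)
    exact ⟨J, hJ⟩
  -- Position `1` of a chain has depth `3`, the level to be protected in the third turn; each chain
  -- has lost only its top vertex.
  let R : Finset (WVertex k l m) := J.image fun i => chain i ⟨1, hn⟩
  have hRl : ∀ v ∈ R, v.depth = 3 := by
    intro v hv
    obtain ⟨i, -, rfl⟩ := Finset.mem_image.1 hv
    rfl
  have hq := W_legal_plan (P := {(x : WVertex k l m)}) (Q := ∅) (R := R) (a := 0) (b := b)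
    (by simp) (by simp) (Finset.card_image_le.trans hJ.le) (by simp [depth]) (by simp) hRl
  have hd : Disjoint (xBranch k l m) (chainsFrom k l m J 1) := by
    simp only [xBranch, starBranch, chainsFrom, Finset.disjoint_left, Finset.mem_insert,
      Finset.mem_image]
    rintro v (rfl | rfl | ⟨i, -, rfl⟩) <;> simp
  have hcard : (xBranch k l m ∪ chainsFrom k l m J 1).card = l + b * ((m - 1) / k - 1) := by
    rw [Finset.card_union_of_disjoint hd, card_xBranch hl, card_chainsFrom, hJ]
  refine ⟨_, hq, hcard.ge.trans (W_card_le_saved hq fun v hv => ?_)⟩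
  simp only [xBranch, starBranch, chainsFrom, Finset.mem_union, Finset.mem_insert,
    Finset.mem_image, Finset.mem_product, Finset.mem_filter, Finset.mem_univ, true_and] at hv
  rcases hv with (rfl | rfl | ⟨i, rfl⟩) | ⟨⟨i, j⟩, ⟨hi, hj⟩, rfl⟩
  · exact ⟨0, x, Finset.mem_singleton_self _, .refl _⟩
  · exact ⟨0, x, Finset.mem_singleton_self _, W_ancestor_x_center⟩
  · exact ⟨0, x, Finset.mem_singleton_self _, W_ancestor_x_center.trans (W_ancestor_center_leaf _)⟩
  · exact ⟨2, chain i ⟨1, hn⟩, Finset.mem_image_of_mem _ hi, W_ancestor_chain i hj⟩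

/-- The first move of a strategy on `W k l m` lies below `x` or below `y`. -/
theorem W_first_move (A : Strategy (W k l m)) :
    (∀ a b, A.play (arrivals a b) 0 ⊆ xBranch k l m) ∨
      ∀ a b, A.play (arrivals a b) 0 ⊆ yBranch k l m := by
  -- All the sequences start with one firefighter, so the adversary may fix `a` and `b` after seeing
  -- the first move.
  have hcausal : ∀ a b, A.play (arrivals a b) 0 = A.play (arrivals 0 0) 0 := fun a b =>
    A.causal _ _ 0 fun s hs => by rw [Nat.le_zero.1 hs]; rfl
  have hleg := A.legal (arrivals 0 0) 0
  have key : ∀ P : Finset (WVertex k l m), P.card ≤ 1 → r ∉ P →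
      P ⊆ xBranch k l m ∨ P ⊆ yBranch k l m := by
    intro P hcard hr
    -- An empty first move is counted on the `x` side, where the bounds hold all the more.
    rcases P.eq_empty_or_nonempty with rfl | ⟨v, hv⟩
    · exact Or.inl (Finset.empty_subset _)
    have hP : ∀ S : Finset (WVertex k l m), v ∈ S → P ⊆ S := fun S hS u hu => by
      rwa [Finset.card_le_one.1 hcard u hu v hv]
    match v with
    | r => exact absurd hv hr
    | x => exact Or.inl (hP _ (by simp [xBranch]))
    | center => exact Or.inl (hP _ (by simp [xBranch, starBranch]))
    | leaf _ => exact Or.inl (hP _ (by simp [xBranch, starBranch]))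
    | y => exact Or.inr (hP _ mem_yBranch_y)
    | chain i j => exact Or.inr (hP _ (mem_yBranch_chain i j))
  refine (key _ hleg.1 fun h => (hleg.2 _ h).1 rfl).imp ?_ ?_ <;>
  · intro h a b
    rw [hcausal]
    exact h

/-- The alternatives in `hx` are the two punishments of the `x` side, one more firefighter in the
second turn or none at all; `hy` is the punishment of the `y` side by `b` firefighters in the third
turn. -/
theorem treeValue_W_le {K b : ℕ} (hl : 2 ≤ l) (hkm : k ∣ m - 1) (hn : 2 ≤ (m - 1) / k)
    (hb : b ≤ k) (hK : 2 ≤ K) (hbK : 1 + b ≤ K) {c : ℝ}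
    (hx : ((l + (m - 1) / k : ℕ) : ℝ) / (m + (l - 1) : ℕ) ≤ c ∨ (l : ℝ) / m ≤ c)
    (hy : ((m + b : ℕ) : ℝ) / (l + b * ((m - 1) / k - 1) : ℕ) ≤ c) :
    treeValue K (W k l m) ≤ c := by
  have hm : 1 ≤ m := by
    by_contra h
    obtain rfl : m = 0 := by omega
    simp at hn
  refine treeValue_le fun A => ?_
  rcases W_first_move A with h | h
  · rcases hx with hx | hx
    · obtain ⟨q, hq, hqs⟩ := W_exists_plan_y_center (l := l) hl hm hkm
      exact ⟨_, arrivals_mem_atMost (by omega), (ratio_le hq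
        (W_saved_le_of_x_of_second hl (A.legal _) (h 1 0)) hqs (by omega)).trans hx⟩
    · obtain ⟨q, hq, hqs⟩ := W_exists_plan_y (l := l) hm hkm
      exact ⟨_, arrivals_mem_atMost (by omega), (ratio_le hq
        (W_saved_le_of_x hl (A.legal _) (h 0 0)) hqs (by omega)).trans hx⟩
  · obtain ⟨q, hq, hqs⟩ := W_exists_plan_x_chains hl hb hn
    exact ⟨_, arrivals_mem_atMost (by omega), (ratio_le hq
      (W_saved_le_of_y hm hkm (A.legal _) (h 0 b)) hqs (by omega)).trans hy⟩

end TreeW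

/-! ### The values of `alpha` -/

section Values

theorem half_le_alpha (k : ℕ) : 1 / 2 ≤ alpha k := by
  obtain ⟨A, hA⟩ := exists_isGreedy
  exact (hA.competitive (atMost k)).le_alpha subset_rfl

/-- Take `k` chains of length `k` and two branches of equal size `k ^ 2 + 1`. One chain, or the top
vertices of all chains, amount to `k` vertices, which is negligible against `k ^ 2`; the ratios are
`(k² + k + 1) / (2k² + 1)` and `(k² + k + 1) / (2k² - k + 1)`. -/
theorem alpha_succ_le {k : ℕ} (hk : 2 ≤ k) : alpha (k + 1) ≤ 1 / 2 + 2 / k := by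
  have hk' : (2 : ℝ) ≤ k := mod_cast hk
  have hdiv : (k ^ 2 + 1 - 1) / k = k := by
    rw [Nat.add_sub_cancel, pow_two, Nat.mul_div_cancel _ (by omega)]
  have hl : 2 ≤ k ^ 2 + 1 := by nlinarith
  refine (alpha_le_treeValue _ (W k (k ^ 2 + 1) (k ^ 2 + 1))).trans
    (treeValue_W_le (b := k) hl ?_ ?_ le_rfl (by omega) (by omega) (Or.inl ?_) ?_)
  · rw [Nat.add_sub_cancel, pow_two]
    exact dvd_mul_left _ _
  · rw [hdiv]
    exact hk
  · rw [hdiv, Nat.add_sub_cancel]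
    push_cast
    rw [div_add_div _ _ two_ne_zero (by positivity),
      div_le_div_iff₀ (by positivity) (by positivity)]
    nlinarith
  · rw [hdiv]
    push_cast [Nat.cast_sub (show 1 ≤ k by omega)]
    rw [div_add_div _ _ two_ne_zero (by positivity),
      div_le_div_iff₀ (by nlinarith) (by positivity)]
    nlinarith

theorem tendsto_alpha : Tendsto alpha atTop (𝓝 (1 / 2)) := by
  rw [← tendsto_add_atTop_iff_nat 1]
  have h : Tendsto (fun k : ℕ => (1 / 2 : ℝ) + 2 / k) atTop (𝓝 (1 / 2 + 0)) :=
    tendsto_const_nhds.add (tendsto_const_div_atTop_nhds_zero_nat 2)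
  rw [add_zero] at h
  refine tendsto_of_tendsto_of_tendsto_of_le_of_le' tendsto_const_nhds h
    (Eventually.of_forall fun k => half_le_alpha _) ?_
  filter_upwards [eventually_ge_atTop 2] with k hk using alpha_succ_le hk

/-- With one chain the two punishments cost about `l / m` and `m / (l + m)`. They balance when `m /
l = φ`, which consecutive Fibonacci numbers approximate. -/
theorem alpha_two_le_max {n : ℕ} (hn : 5 ≤ n) :
    alpha 2 ≤ max ((Nat.fib n : ℝ) / Nat.fib (n + 1))
      ((Nat.fib (n + 1) + 1 : ℝ) / (Nat.fib (n + 2) - 2)) := by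
  have h1 : n ≤ Nat.fib n := Nat.le_fib_self hn
  have h2 : n + 1 ≤ Nat.fib (n + 1) := Nat.le_fib_self (by omega)
  refine (alpha_le_treeValue _ (W 1 (Nat.fib n) (Nat.fib (n + 1)))).trans
    (treeValue_W_le (b := 1) (by omega) (one_dvd _) (by rw [Nat.div_one]; omega) le_rfl le_rfl
      (by omega) (Or.inr (le_max_left _ _)) (le_max_of_le_right (le_of_eq ?_)))
  have h3 : Nat.fib n + 1 * ((Nat.fib (n + 1) - 1) / 1 - 1) + 2 = Nat.fib (n + 2) := by
    rw [Nat.fib_add_two, Nat.div_one]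
    omega
  rw [← h3]
  push_cast
  congr 1
  ring

theorem alpha_two_le : alpha 2 ≤ 1 / Real.goldenRatio := by
  have hφ : 1 / Real.goldenRatio = -Real.goldenConj := by rw [one_div, Real.inv_goldenRatio]
  have h1 : Tendsto (fun n => (Nat.fib n : ℝ) / Nat.fib (n + 1)) atTop
      (𝓝 (1 / Real.goldenRatio)) := hφ ▸ tendsto_fib_div_fib_succ_atTop
  have hF : Tendsto (fun n => (Nat.fib (n + 2) : ℝ)) atTop atTop := by
    refine tendsto_natCast_atTop_atTop.comp (tendsto_atTop_mono' atTop ?_ tendsto_id)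
    filter_upwards [eventually_ge_atTop 5] with n hn
    exact (Nat.le_fib_self hn).trans (Nat.fib_mono (by omega))
  have h2 : Tendsto (fun n => (Nat.fib (n + 1) + 1 : ℝ) / (Nat.fib (n + 2) - 2)) atTop
      (𝓝 (1 / Real.goldenRatio)) := by
    -- Numerator and denominator are divided by `Nat.fib (n + 2)`.
    have h3 := (((tendsto_add_atTop_iff_nat 1).2 h1).add
      (tendsto_const_nhds (x := (1 : ℝ)).div_atTop hF)).div
      (tendsto_const_nhds (x := (1 : ℝ)).sub (tendsto_const_nhds (x := (2 : ℝ)).div_atTop hF))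
      (by norm_num)
    rw [add_zero, sub_zero, div_one] at h3
    refine h3.congr fun n => ?_
    have hpos : (Nat.fib (n + 2) : ℝ) ≠ 0 := by
      exact_mod_cast (Nat.fib_pos.2 (by omega)).ne'
    simp only [Pi.div_apply]
    rw [← add_div, one_sub_div hpos, div_div_div_cancel_right₀ hpos]
  have h3 := h1.max h2
  rw [max_self] at h3
  refine ge_of_tendsto h3 ?_
  filter_upwards [eventually_ge_atTop 5] with n hn using alpha_two_le_max hn

theorem alpha_two : alpha 2 = 1 / Real.goldenRatio := by
  obtain ⟨A, hA⟩ := exists_isTwoFirefighterAlgorithm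
  exact le_antisymm alpha_two_le (hA.competitive.le_alpha subset_rfl)

theorem treeValue_four_W_lt : treeValue 4 (W 4 901 1001) < 1 / Real.goldenRatio := by
  have hφ : Real.goldenRatio < 1.62 := by
    have h : √5 < 2.24 := by
      rw [Real.sqrt_lt' (by norm_num)]
      norm_num
    rw [Real.goldenRatio]
    linarith
  have hlt : (1 / 1.62 : ℝ) < 1 / Real.goldenRatio :=
    one_div_lt_one_div_of_lt Real.goldenRatio_pos hφ
  refine lt_of_le_of_lt ?_ hlt
  -- The chains have length `250`. The two ratios are `1151 / 1901 ≈ 0.605` and, with only three of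
  -- the four chains rescued, `1004 / 1648 ≈ 0.609`, both below `1 / 1.62 ≈ 0.617`.
  exact treeValue_W_le (b := 3) (by norm_num) (by norm_num) (by norm_num) (by norm_num)
    (by norm_num) (by norm_num) (Or.inl (by norm_num)) (by norm_num)

end Values

end Firefighter

theorem mainTheorem3 :
    (∀ k : ℕ, 2 ≤ k → 1 / 2 ≤ Firefighter.alpha k ∧
      Firefighter.alpha k ≤ 1 / Real.goldenRatio) ∧
    (Tendsto Firefighter.alpha atTop (𝓝 (1 / 2)) ∧
      (∃ A, Firefighter.IsGreedy A) ∧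
      ∀ A, Firefighter.IsGreedy A → Firefighter.OptimalWithRatio A Set.univ (1 / 2)) ∧
    (Firefighter.alpha 2 = 1 / Real.goldenRatio ∧
      (∃ A, Firefighter.IsTwoFirefighterAlgorithm A) ∧
      ∀ A, Firefighter.IsTwoFirefighterAlgorithm A →
        Firefighter.OptimalWithRatio A (Firefighter.atMost 2) (1 / Real.goldenRatio)) ∧
    (Firefighter.treeValue 4 (Firefighter.W 4 901 1001) < 1 / Real.goldenRatio ∧
      Firefighter.alpha 4 < 1 / Real.goldenRatio) := by
  refine ⟨fun k hk => ⟨Firefighter.half_le_alpha k, ?_⟩,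
    ⟨Firefighter.tendsto_alpha, Firefighter.exists_isGreedy, fun A hA => ⟨hA.competitive _, ?_⟩⟩,
    ⟨Firefighter.alpha_two, Firefighter.exists_isTwoFirefighterAlgorithm,
      fun A hA => ⟨hA.competitive, ?_⟩⟩,
    Firefighter.treeValue_four_W_lt,
    (Firefighter.alpha_le_treeValue _ _).trans_lt Firefighter.treeValue_four_W_lt⟩
  · exact (Firefighter.alpha_anti hk).trans Firefighter.alpha_two_le
  · intro B γ hB
    -- A ratio guaranteed on all sequences is at most `alpha k` for every `k`, hence at most the
    -- limit.
    exact ge_of_tendsto' Firefighter.tendsto_alpha fun k => hB.le_alpha (Set.subset_univ _)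
  · intro B γ hB
    exact (hB.le_alpha subset_rfl).trans Firefighter.alpha_two_le
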